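/- Let $n\ge 1$ be an integer, let $s\in(0,1]$ with $s<n$, and put $p=n/s$. For $u:\mathbb{R}^n\to\mathbb{R}$ in $L^p_{\rm loc}(\mathbb{R}^n)$ set $$[u]_{W^{s,p}}=\Big(s(1-s)\iint_{\mathbb{R}^n\times\mathbb{R}^n}\frac{|u(x)-u(y)|^p}{|x-y|^{n+sp}}\,dx\,dy\Big)^{1/p}\quad(0<s<1),\qquad [u]_{W^{1,p}}=\|\nabla u\|_{L^p(\mathbb{R}^n)}\quad(s=1),$$ where $\nabla u$ is the weak gradient (and $[u]_{W^{1,p}}=+\infty$ if $u$ has no weak gradient). Let $\mathcal{D}^{s,p}(\mathbb{R}^n)$ be the completion of $C_c^\infty(\mathbb{R}^n)$ with respect to $[\,\cdot\,]_{W^{s,p}}$. Let $$\mathcal{L}^{p,n}(\mathbb{R}^n)=\Big\{u\in L^p_{\rm loc}(\mathbb{R}^n):\ \sup_{x_0\in\mathbb{R}^n,\ \varrho>0}\varrho^{-n}\int_{B_\varrho(x_0)}|u-u_{x_0,\varrho}|^p\,dx<+\infty\Big\},\qquad u_{x_0,\varrho}=\frac{1}{|B_\varrho(x_0)|}\int_{B_\varrho(x_0)}u\,dx,$$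 be the Campanato space, and let $$\dot W^{s,p}(\mathbb{R}^n)=\big\{v\in\mathcal{L}^{p,n}(\mathbb{R}^n):\ [v]_{W^{s,p}}<+\infty\big\}\big/\!\sim_C,\qquad u\sim_C v\iff u-v\ \text{is constant almost everywhere},$$ endowed with $\|\{u\}_C\|=[u]_{W^{s,p}}$, where $\{u\}_C$ is the class of $u$. Then $\|\cdot\|$ is a norm on $\dot W^{s,p}(\mathbb{R}^n)$, for which it is a Banach space, and there exists a (surjective) linear isometric isomorphism $$\mathcal{J}:\mathcal{D}^{s,p}(\mathbb{R}^n)\to\dot W^{s,p}(\mathbb{R}^n),$$ which identifies the two spaces in the natural way: every $\varphi\in C_c^\infty(\mathbb{R}^n)$ belongs to $\mathcal{L}^{p,n}(\mathbb{R}^n)$ with $[\varphi]_{W^{s,p}}<+\infty$, and $\mathcal{J}$ maps the element of $\mathcal{D}^{s,p}(\mathbb{R}^n)$ given by $\varphi$ to $\{\varphi\}_C$. -/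

import Mathlib

noncomputable section

open MeasureTheory Set Metric
open scoped ENNReal ContDiff

namespace HomSobolev

/-- The Euclidean space `ℝⁿ`. -/
abbrev Euc (n : ℕ) : Type := EuclideanSpace ℝ (Fin n)

/-! ### Local Lebesgue spaces, weak gradients, Gagliardo-Slobodeckii seminorm -/

/-- `u ∈ L^p_loc(ℝⁿ)`. -/
def MemLpLoc (n : ℕ) (p : ℝ) (u : Euc n → ℝ) : Prop :=
  AEStronglyMeasurable u volume ∧
    ∀ K : Set (Euc n), IsCompact K → MemLp u (ENNReal.ofReal p) (volume.restrict K)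

/-- `φ ∈ C_c^∞(ℝⁿ)`. -/
def IsTest (n : ℕ) (φ : Euc n → ℝ) : Prop :=
  ContDiff ℝ ∞ φ ∧ HasCompactSupport φ

/-- `G` is the weak (distributional) gradient of `u`: it is locally integrable and
`∫ u ∂_v φ = - ∫ (G · v) φ` for every direction `v` and every `φ ∈ C_c^∞(ℝⁿ)`. -/
def IsWeakGradient (n : ℕ) (u : Euc n → ℝ) (G : Euc n → Euc n) : Prop :=
  LocallyIntegrable G volume ∧
    ∀ φ : Euc n → ℝ, IsTest n φ → ∀ v : Euc n,
      ∫ x, u x * fderiv ℝ φ x v = - ∫ x, inner ℝ (G x) v * φ x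

/-- The double integral `∬ |u(x) - u(y)|^p / |x - y|^(n + s p) dx dy`, with values in `[0, ∞]`. -/
def gagliardoIntegral (n : ℕ) (s p : ℝ) (u : Euc n → ℝ) : ℝ≥0∞ :=
  ∫⁻ z : Euc n × Euc n, ‖u z.1 - u z.2‖ₑ ^ p / ‖z.1 - z.2‖ₑ ^ ((n : ℝ) + s * p)

/-- `‖∇u‖_{L^p}` with values in `[0, ∞]`; it is `∞` if `u` has no weak gradient. (Weak gradients
are unique almost everywhere, so the infimum is over a single value.) -/
def gradNorm (n : ℕ) (p : ℝ) (u : Euc n → ℝ) : ℝ≥0∞ :=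
  ⨅ (G : Euc n → Euc n) (_ : IsWeakGradient n u G), eLpNorm G (ENNReal.ofReal p) volume

/-- The normalized Gagliardo-Slobodeckii seminorm `[u]_{W^{s,p}(ℝⁿ)}`, `s ∈ (0,1]`, with values
in `[0, ∞]`: for `s = 1` it is `‖∇u‖_{L^p}`, for `s ∈ (0,1)` it is
`(s (1-s) ∬ |u(x) - u(y)|^p / |x - y|^(n + s p) dx dy)^(1/p)`. -/
def gagliardo (n : ℕ) (s p : ℝ) (u : Euc n → ℝ) : ℝ≥0∞ :=
  open Classical in
  if s = 1 then gradNorm n p u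
  else (ENNReal.ofReal (s * (1 - s)) * gagliardoIntegral n s p u) ^ (1 / p)

/-! ### Campanato seminorm -/

/-- The Campanato seminorm `[u]_{𝓛^{p,λ}(ℝⁿ)}`, with values in `[0, ∞]`, the supremum over all
balls `B_ρ(x₀)` of `ρ^(-λ/p) (∫_{B_ρ(x₀)} |u - u_{x₀,ρ}|^p)^(1/p)`. -/
def campanato (n : ℕ) (p lam : ℝ) (u : Euc n → ℝ) : ℝ≥0∞ :=
  ⨆ (x₀ : Euc n) (ρ : ℝ) (_ : 0 < ρ),
    ENNReal.ofReal (ρ ^ (-lam / p)) *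
      (∫⁻ x in ball x₀ ρ, ‖u x - ⨍ y in ball x₀ ρ, u y‖ₑ ^ p) ^ (1 / p)

/-! ### Basic facts: these are seminorms -/

lemma minkowski {α : Type*} [MeasurableSpace α] {μ : Measure α} {p : ℝ} (hp : 1 ≤ p)
    {f g h : α → ℝ≥0∞} (hf : AEMeasurable f μ) (hg : AEMeasurable g μ) (hh : ∀ a, h a ≤ f a + g a) :
    (∫⁻ a, h a ^ p ∂μ) ^ (1 / p) ≤
      (∫⁻ a, f a ^ p ∂μ) ^ (1 / p) + (∫⁻ a, g a ^ p ∂μ) ^ (1 / p) := by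
  have hp0 : 0 ≤ p := by linarith
  refine le_trans ?_ (ENNReal.lintegral_Lp_add_le hf hg hp)
  refine ENNReal.rpow_le_rpow (lintegral_mono fun a => ?_) (by positivity)
  exact ENNReal.rpow_le_rpow (hh a) hp0

lemma MemLpLoc.locallyIntegrable {n : ℕ} {p : ℝ} (hp : 1 ≤ p) {u : Euc n → ℝ}
    (hu : MemLpLoc n p u) : LocallyIntegrable u volume := by
  rw [locallyIntegrable_iff]
  intro K hK
  have : IsFiniteMeasure (volume.restrict K) := ⟨by simpa using hK.measure_lt_top⟩
  exact (hu.2 K hK).integrable (by simpa using hp)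

lemma MemLpLoc.add {n : ℕ} {p : ℝ} {u v : Euc n → ℝ}
    (hu : MemLpLoc n p u) (hv : MemLpLoc n p v) : MemLpLoc n p (u + v) :=
  ⟨hu.1.add hv.1, fun K hK => (hu.2 K hK).add (hv.2 K hK)⟩

lemma MemLpLoc.smul {n : ℕ} {p : ℝ} {u : Euc n → ℝ} (c : ℝ)
    (hu : MemLpLoc n p u) : MemLpLoc n p (c • u) :=
  ⟨hu.1.const_smul c, fun K hK => (hu.2 K hK).const_smul c⟩

lemma memLpLoc_zero (n : ℕ) (p : ℝ) : MemLpLoc n p 0 :=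
  ⟨aestronglyMeasurable_zero, fun _ _ => MemLp.zero⟩

lemma integrable_mul_test {n : ℕ} {u ψ : Euc n → ℝ} (hu : LocallyIntegrable u volume)
    (hψ : Continuous ψ) (hc : HasCompactSupport ψ) : Integrable (fun x => u x * ψ x) volume := by
  have := hu.integrable_smul_left_of_hasCompactSupport hψ hc
  simpa [mul_comm] using this

lemma IsTest.continuous_fderiv {n : ℕ} {φ : Euc n → ℝ} (h : IsTest n φ) (v : Euc n) :
    Continuous (fun x => fderiv ℝ φ x v) :=
  (h.1.continuous_fderiv (by simp)).clm_apply continuous_const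

lemma IsTest.compact_fderiv {n : ℕ} {φ : Euc n → ℝ} (h : IsTest n φ) (v : Euc n) :
    HasCompactSupport (fun x => fderiv ℝ φ x v) :=
  h.2.fderiv_apply (𝕜 := ℝ) v

lemma locallyIntegrable_inner {n : ℕ} {G : Euc n → Euc n} (hG : LocallyIntegrable G volume)
    (v : Euc n) : LocallyIntegrable (fun x => inner ℝ (G x) v) volume := by
  rw [locallyIntegrable_iff] at hG ⊢
  intro K hK
  exact (hG K hK).inner_const v

lemma IsWeakGradient.add {n : ℕ} {u v : Euc n → ℝ} {G H : Euc n → Euc n}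
    (hu' : LocallyIntegrable u volume) (hv' : LocallyIntegrable v volume)
    (hu : IsWeakGradient n u G) (hv : IsWeakGradient n v H) :
    IsWeakGradient n (u + v) (G + H) := by
  refine ⟨hu.1.add hv.1, fun φ hφ w => ?_⟩
  have h1 := integrable_mul_test hu' (hφ.continuous_fderiv w) (hφ.compact_fderiv w)
  have h2 := integrable_mul_test hv' (hφ.continuous_fderiv w) (hφ.compact_fderiv w)
  have h3 := integrable_mul_test (locallyIntegrable_inner hu.1 w) hφ.1.continuous hφ.2
  have h4 := integrable_mul_test (locallyIntegrable_inner hv.1 w) hφ.1.continuous hφ.2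
  simp only [Pi.add_apply, add_mul, inner_add_left]
  rw [integral_add h1 h2, integral_add h3 h4, hu.2 φ hφ w, hv.2 φ hφ w]
  ring

lemma IsWeakGradient.smul {n : ℕ} {u : Euc n → ℝ} {G : Euc n → Euc n} (c : ℝ)
    (hu : IsWeakGradient n u G) : IsWeakGradient n (c • u) (c • G) := by
  refine ⟨hu.1.smul c, fun φ hφ w => ?_⟩
  simp only [Pi.smul_apply, smul_eq_mul, inner_smul_left, mul_assoc]
  simp [integral_const_mul, hu.2 φ hφ w]

lemma gradNorm_add_le {n : ℕ} {p : ℝ} (hp : 1 ≤ p) {u v : Euc n → ℝ}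
    (hu : LocallyIntegrable u volume) (hv : LocallyIntegrable v volume) :
    gradNorm n p (u + v) ≤ gradNorm n p u + gradNorm n p v := by
  unfold gradNorm
  rw [ENNReal.iInf₂_add]
  refine le_iInf₂ fun G hG => ?_
  rw [ENNReal.add_iInf₂]
  refine le_iInf₂ fun H hH => ?_
  refine (iInf₂_le (G + H) (hG.add hu hv hH)).trans ?_
  exact eLpNorm_add_le hG.1.aestronglyMeasurable hH.1.aestronglyMeasurable (by simpa using hp)

lemma gradNorm_zero (n : ℕ) (p : ℝ) : gradNorm n p 0 = 0 := by
  have h0 : IsWeakGradient n 0 0 := by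
    refine ⟨locallyIntegrable_zero, fun φ hφ w => by simp⟩
  refine le_antisymm ((iInf₂_le 0 h0).trans ?_) bot_le
  simp

lemma gradNorm_smul_le {n : ℕ} {p : ℝ} (c : ℝ) (u : Euc n → ℝ) :
    gradNorm n p (c • u) ≤ ‖c‖ₑ * gradNorm n p u := by
  rcases eq_or_ne c 0 with rfl | hc
  · simp [gradNorm_zero]
  have hc0 : ‖c‖ₑ ≠ 0 := by simpa using hc
  unfold gradNorm
  rw [ENNReal.mul_iInf_of_ne hc0 (by simp)]
  refine le_iInf fun G => ?_
  rw [ENNReal.mul_iInf_of_ne hc0 (by simp)]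
  refine le_iInf fun hG => ?_
  refine (iInf₂_le (c • G) (hG.smul c)).trans ?_
  exact (eLpNorm_const_smul c G _ _).le

lemma gagliardoIntegral_eq {n : ℕ} {s p : ℝ} (hp : 1 ≤ p) (u : Euc n → ℝ) :
    gagliardoIntegral n s p u = ∫⁻ z : Euc n × Euc n,
      (‖u z.1 - u z.2‖ₑ * ((‖z.1 - z.2‖ₑ ^ ((n : ℝ) + s * p))⁻¹) ^ (1 / p)) ^ p := by
  have hp0 : 0 < p := by linarith
  unfold gagliardoIntegral
  congr 1
  ext z
  rw [ENNReal.mul_rpow_of_nonneg _ _ hp0.le, ← ENNReal.rpow_mul, one_div_mul_cancel hp0.ne',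
    ENNReal.rpow_one, div_eq_mul_inv]

lemma aemeasurable_gagliardo {n : ℕ} {s p : ℝ} {u : Euc n → ℝ}
    (hu : AEStronglyMeasurable u volume) :
    AEMeasurable (fun z : Euc n × Euc n =>
      ‖u z.1 - u z.2‖ₑ * ((‖z.1 - z.2‖ₑ ^ ((n : ℝ) + s * p))⁻¹) ^ (1 / p)) volume := by
  have h1 : AEStronglyMeasurable (fun z : Euc n × Euc n => u z.1 - u z.2) volume :=
    (hu.comp_quasiMeasurePreserving Measure.quasiMeasurePreserving_fst).sub
      (hu.comp_quasiMeasurePreserving Measure.quasiMeasurePreserving_snd)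
  refine h1.enorm.mul (Measurable.aemeasurable ?_)
  fun_prop

lemma gagliardo_add_le {n : ℕ} {s p : ℝ} (hp : 1 ≤ p) {u v : Euc n → ℝ}
    (hu : MemLpLoc n p u) (hv : MemLpLoc n p v) :
    gagliardo n s p (u + v) ≤ gagliardo n s p u + gagliardo n s p v := by
  unfold gagliardo
  split_ifs with hs
  · exact gradNorm_add_le hp (hu.locallyIntegrable hp) (hv.locallyIntegrable hp)
  · have hp' : 0 ≤ 1 / p := by positivity
    simp only [ENNReal.mul_rpow_of_nonneg _ _ hp', ← mul_add]
    gcongr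
    simp only [gagliardoIntegral_eq hp]
    refine minkowski hp (aemeasurable_gagliardo hu.1) (aemeasurable_gagliardo hv.1) fun z => ?_
    rw [← add_mul]
    gcongr
    refine le_trans (le_of_eq ?_) (enorm_add_le _ _)
    congr 1
    simp only [Pi.add_apply]
    ring

lemma gagliardo_smul_le {n : ℕ} {s p : ℝ} (hp : 1 ≤ p) (c : ℝ) (u : Euc n → ℝ) :
    gagliardo n s p (c • u) ≤ ‖c‖ₑ * gagliardo n s p u := by
  unfold gagliardo
  split_ifs with hs
  · exact gradNorm_smul_le c u
  · have hp0 : 0 < p := by linarith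
    have hp' : 0 ≤ 1 / p := by positivity
    have : gagliardoIntegral n s p (c • u) = ‖c‖ₑ ^ p * gagliardoIntegral n s p u := by
      unfold gagliardoIntegral
      rw [← lintegral_const_mul' _ _ (by simp [hp0.le])]
      congr 1
      ext z
      simp only [Pi.smul_apply, ← smul_sub, enorm_smul, ENNReal.mul_rpow_of_nonneg _ _ hp0.le,
        mul_div_assoc]
    rw [this, mul_left_comm, ENNReal.mul_rpow_of_nonneg _ _ hp', ← ENNReal.rpow_mul,
      mul_one_div_cancel hp0.ne', ENNReal.rpow_one]

lemma gagliardo_zero {n : ℕ} {s p : ℝ} (hp : 1 ≤ p) : gagliardo n s p 0 = 0 := by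
  have := gagliardo_smul_le (n := n) (s := s) hp 0 0
  simpa using this

lemma campanato_zero {n : ℕ} {p lam : ℝ} (hp : 1 ≤ p) : campanato n p lam 0 = 0 := by
  have hp0 : 0 < p := by linarith
  simp [campanato, hp0]

lemma campanato_add_le {n : ℕ} {p lam : ℝ} (hp : 1 ≤ p) {u v : Euc n → ℝ}
    (hu : MemLpLoc n p u) (hv : MemLpLoc n p v) :
    campanato n p lam (u + v) ≤ campanato n p lam u + campanato n p lam v := by
  refine iSup_le fun x₀ => iSup₂_le fun ρ hρ => ?_
  refine le_trans ?_ (add_le_add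
    (le_iSup_of_le x₀ (le_iSup₂_of_le ρ hρ le_rfl)) (le_iSup_of_le x₀ (le_iSup₂_of_le ρ hρ le_rfl)))
  rw [← mul_add]
  gcongr
  have hint : ∀ {w : Euc n → ℝ}, MemLpLoc n p w → IntegrableOn w (ball x₀ ρ) volume := by
    intro w hw
    exact ((hw.locallyIntegrable hp).integrableOn_isCompact (isCompact_closedBall x₀ ρ)).mono_set
      ball_subset_closedBall
  refine minkowski hp (hu.1.restrict.sub aestronglyMeasurable_const).enorm
    (hv.1.restrict.sub aestronglyMeasurable_const).enorm fun x => ?_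
  refine le_trans (le_of_eq ?_) (enorm_add_le _ _)
  congr 1
  have : ⨍ y in ball x₀ ρ, (u + v) y = (⨍ y in ball x₀ ρ, u y) + ⨍ y in ball x₀ ρ, v y := by
    simp only [setAverage_eq, Pi.add_apply]
    rw [integral_add (hint hu) (hint hv), smul_add]
  rw [this, Pi.add_apply]
  ring

lemma campanato_smul_le {n : ℕ} {p lam : ℝ} (hp : 1 ≤ p) (c : ℝ) (u : Euc n → ℝ) :
    campanato n p lam (c • u) ≤ ‖c‖ₑ * campanato n p lam u := by
  have hp0 : 0 < p := by linarith
  have hp' : 0 ≤ 1 / p := by positivity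
  refine iSup_le fun x₀ => iSup₂_le fun ρ hρ => ?_
  refine le_trans (le_of_eq ?_) (mul_le_mul_right
    (le_iSup_of_le x₀ (le_iSup₂_of_le ρ hρ le_rfl)) _)
  rw [mul_left_comm]
  congr 1
  have : ∀ x, ‖(c • u) x - ⨍ y in ball x₀ ρ, (c • u) y‖ₑ ^ p =
      ‖c‖ₑ ^ p * ‖u x - ⨍ y in ball x₀ ρ, u y‖ₑ ^ p := by
    intro x
    rw [← ENNReal.mul_rpow_of_nonneg _ _ hp0.le, ← enorm_smul, smul_sub]
    congr 3
    simp only [setAverage_eq, Pi.smul_apply]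
    rw [integral_smul, smul_comm]
  simp only [this]
  rw [lintegral_const_mul' _ _ (by simp [hp0.le]), ENNReal.mul_rpow_of_nonneg _ _ hp',
    ← ENNReal.rpow_mul, mul_one_div_cancel hp0.ne', ENNReal.rpow_one]

/-! ### The quotient space `Ẇ^{s,p}` -/

/-- The Campanato space `𝓛^{p,λ}(ℝⁿ)`, as a space of functions. -/
def campanatoSpace (n : ℕ) (p lam : ℝ) (hp : 1 ≤ p) : Submodule ℝ (Euc n → ℝ) where
  carrier := {u | MemLpLoc n p u ∧ campanato n p lam u < ⊤}
  zero_mem' := ⟨memLpLoc_zero n p, by simp [campanato_zero hp]⟩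
  add_mem' := fun {u v} hu hv => ⟨hu.1.add hv.1,
    (campanato_add_le hp hu.1 hv.1).trans_lt (ENNReal.add_lt_top.2 ⟨hu.2, hv.2⟩)⟩
  smul_mem' := fun c u hu => ⟨hu.1.smul c,
    (campanato_smul_le hp c u).trans_lt (ENNReal.mul_lt_top (by simp) hu.2)⟩

/-- The space `{v ∈ 𝓛^{p,n}(ℝⁿ) : [v]_{W^{s,p}(ℝⁿ)} < ∞}`, as a space of functions. -/
def preW (n : ℕ) (s p : ℝ) (hp : 1 ≤ p) : Submodule ℝ (Euc n → ℝ) where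
  carrier := {v | v ∈ campanatoSpace n p n hp ∧ gagliardo n s p v < ⊤}
  zero_mem' := ⟨zero_mem _, by simp [gagliardo_zero hp]⟩
  add_mem' := fun {u v} hu hv => ⟨add_mem hu.1 hv.1,
    (gagliardo_add_le hp hu.1.1 hv.1.1).trans_lt (ENNReal.add_lt_top.2 ⟨hu.2, hv.2⟩)⟩
  smul_mem' := fun c u hu => ⟨Submodule.smul_mem _ c hu.1,
    (gagliardo_smul_le hp c u).trans_lt (ENNReal.mul_lt_top (by simp) hu.2)⟩

/-- The functions that are constant almost everywhere. -/
def aeConst (n : ℕ) : Submodule ℝ (Euc n → ℝ) where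
  carrier := {u | ∃ c : ℝ, ∀ᵐ x, u x = c}
  zero_mem' := ⟨0, by simp⟩
  add_mem' := by
    rintro u v ⟨a, ha⟩ ⟨b, hb⟩
    refine ⟨a + b, ?_⟩
    filter_upwards [ha, hb] with x h1 h2
    simp [h1, h2]
  smul_mem' := by
    rintro c u ⟨a, ha⟩
    refine ⟨c * a, ?_⟩
    filter_upwards [ha] with x h1
    simp [h1]

/-- `Ẇ^{s,p}(ℝⁿ) = {v ∈ 𝓛^{p,n}(ℝⁿ) : [v]_{W^{s,p}(ℝⁿ)} < ∞} / ∼`, where `u ∼ v` means that `u - v`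
is constant almost everywhere (the definition is used for `s p = n`). -/
def WDot (n : ℕ) (s p : ℝ) (hp : 1 ≤ p) : Type :=
  preW n s p hp ⧸ (aeConst n).submoduleOf (preW n s p hp)

instance (n : ℕ) (s p : ℝ) (hp : 1 ≤ p) : AddCommGroup (WDot n s p hp) :=
  inferInstanceAs (AddCommGroup (preW n s p hp ⧸ (aeConst n).submoduleOf (preW n s p hp)))

instance (n : ℕ) (s p : ℝ) (hp : 1 ≤ p) : Module ℝ (WDot n s p hp) :=
  inferInstanceAs (Module ℝ (preW n s p hp ⧸ (aeConst n).submoduleOf (preW n s p hp)))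

/-- The class `{v}` of `v` modulo constants. -/
def WDot.mk {n : ℕ} {s p : ℝ} {hp : 1 ≤ p} : preW n s p hp →ₗ[ℝ] WDot n s p hp :=
  ((aeConst n).submoduleOf (preW n s p hp)).mkQ

lemma gagliardo_aeConst {n : ℕ} {s p : ℝ} (hp : 1 ≤ p) {u : Euc n → ℝ} (hu : u ∈ aeConst n) :
    gagliardo n s p u = 0 := by
  obtain ⟨c, hc⟩ := hu
  have hp0 : 0 < p := by linarith
  unfold gagliardo
  split_ifs with hs
  · have h0 : IsWeakGradient n u 0 := by
      refine ⟨locallyIntegrable_zero, fun φ hφ w => ?_⟩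
      have h1 : ∫ x, u x * fderiv ℝ φ x w = ∫ x, (fun _ => c) x * fderiv ℝ φ x w := by
        refine integral_congr_ae ?_
        filter_upwards [hc] with x hx
        rw [hx]
      have h3 := integral_mul_fderiv_eq_neg_fderiv_mul_of_integrable (μ := volume)
        (f := fun _ : Euc n => c) (g := φ) (v := w) (by simp)
        (((hφ.continuous_fderiv w).integrable_of_hasCompactSupport (hφ.compact_fderiv w)).const_mul c)
        ((hφ.1.continuous.integrable_of_hasCompactSupport hφ.2).const_mul c)
        (fun x _ => by fun_prop) (fun x _ => (hφ.1.differentiable (by simp)) x)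
      rw [h1, h3]
      simp
    refine le_antisymm ((iInf₂_le 0 h0).trans ?_) bot_le
    simp
  · have : gagliardoIntegral n s p u = 0 := by
      unfold gagliardoIntegral
      have h1 : ∀ᵐ z : Euc n × Euc n, u z.1 = c :=
        Measure.quasiMeasurePreserving_fst.ae hc
      have h2 : ∀ᵐ z : Euc n × Euc n, u z.2 = c :=
        Measure.quasiMeasurePreserving_snd.ae hc
      rw [← lintegral_zero (μ := (volume : Measure (Euc n × Euc n)))]
      refine lintegral_congr_ae ?_
      filter_upwards [h1, h2] with z h1 h2
      simp [h1, h2, hp0]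
    simp [this, hp0]

lemma memLpLoc_of_mem_preW {n : ℕ} {s p : ℝ} {hp : 1 ≤ p} (u : preW n s p hp) :
    MemLpLoc n p u.1 := u.2.1.1

lemma gagliardo_toReal_add_le {n : ℕ} {s p : ℝ} (hp : 1 ≤ p) {u v : Euc n → ℝ}
    (hu : MemLpLoc n p u) (hv : MemLpLoc n p v)
    (hu' : gagliardo n s p u < ⊤) (hv' : gagliardo n s p v < ⊤) :
    (gagliardo n s p (u + v)).toReal ≤ (gagliardo n s p u).toReal + (gagliardo n s p v).toReal := by
  rw [← ENNReal.toReal_add hu'.ne hv'.ne]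
  exact ENNReal.toReal_mono (ENNReal.add_lt_top.2 ⟨hu', hv'⟩).ne (gagliardo_add_le hp hu hv)

lemma gagliardo_toReal_smul_le {n : ℕ} {s p : ℝ} (hp : 1 ≤ p) (c : ℝ) {u : Euc n → ℝ}
    (hu' : gagliardo n s p u < ⊤) :
    (gagliardo n s p (c • u)).toReal ≤ ‖c‖ * (gagliardo n s p u).toReal := by
  have := ENNReal.toReal_mono (ENNReal.mul_lt_top (by simp) hu').ne
    (gagliardo_smul_le (s := s) hp c u)
  simpa using this

lemma gagliardo_neg {n : ℕ} {s p : ℝ} (hp : 1 ≤ p) (u : Euc n → ℝ) :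
    gagliardo n s p (-u) = gagliardo n s p u := by
  have h : ∀ v : Euc n → ℝ, gagliardo n s p (-v) ≤ gagliardo n s p v := by
    intro v
    have := gagliardo_smul_le (s := s) hp (-1) v
    simpa using this
  refine le_antisymm (h u) ?_
  have := h (-u)
  simpa using this

/-- The norm `‖{u}‖ = [u]_{W^{s,p}(ℝⁿ)}` on `Ẇ^{s,p}(ℝⁿ)`. -/
def WDot.norm {n : ℕ} {s p : ℝ} {hp : 1 ≤ p} : WDot n s p hp → ℝ :=
  Quotient.lift (fun u : preW n s p hp => (gagliardo n s p u.1).toReal) (by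
    have key : ∀ a b : preW n s p hp, (a - b : preW n s p hp).1 ∈ aeConst n →
        gagliardo n s p a.1 ≤ gagliardo n s p b.1 := by
      intro a b h
      have h1 := gagliardo_add_le (s := s) hp (memLpLoc_of_mem_preW (a - b))
        (memLpLoc_of_mem_preW b)
      rw [gagliardo_aeConst hp h, zero_add] at h1
      simpa using h1
    intro a b hab
    have h : (a - b : preW n s p hp).1 ∈ aeConst n :=
      (Submodule.quotientRel_def ((aeConst n).submoduleOf (preW n s p hp))).1 hab
    have h' : (b - a : preW n s p hp).1 ∈ aeConst n := by
      have := neg_mem h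
      rwa [← Submodule.coe_neg, neg_sub] at this
    exact congrArg ENNReal.toReal (le_antisymm (key a b h) (key b a h')))

instance (n : ℕ) (s p : ℝ) (hp : 1 ≤ p) : SeminormedAddCommGroup (WDot n s p hp) :=
  AddGroupSeminorm.toSeminormedAddCommGroup
    { toFun := WDot.norm
      map_zero' := by
        change (gagliardo n s p 0).toReal = 0
        simp [gagliardo_zero hp]
      add_le' := by
        intro a b
        induction a using Quotient.inductionOn with | _ a
        induction b using Quotient.inductionOn with | _ b
        exact gagliardo_toReal_add_le hp (memLpLoc_of_mem_preW a) (memLpLoc_of_mem_preW b)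
          a.2.2 b.2.2
      neg' := by
        intro a
        induction a using Quotient.inductionOn with | _ a
        exact congrArg ENNReal.toReal (gagliardo_neg hp a.1) }

instance (n : ℕ) (s p : ℝ) (hp : 1 ≤ p) : NormedSpace ℝ (WDot n s p hp) where
  norm_smul_le := by
    intro c a
    induction a using Quotient.inductionOn with | _ a
    exact gagliardo_toReal_smul_le hp c a.2.2

lemma WDot.norm_mk {n : ℕ} {s p : ℝ} {hp : 1 ≤ p} (u : preW n s p hp) :
    ‖(WDot.mk u : WDot n s p hp)‖ = (gagliardo n s p u.1).toReal := rfl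

lemma WDot.mk_eq_mk_iff {n : ℕ} {s p : ℝ} {hp : 1 ≤ p} (u v : preW n s p hp) :
    (WDot.mk u : WDot n s p hp) = WDot.mk v ↔ ∃ c : ℝ, ∀ᵐ x, u.1 x - v.1 x = c :=
  Submodule.Quotient.eq _

/-! ### The homogeneous Sobolev space `𝓓^{s,p}` -/

lemma integrable_profile {n : ℕ} (hn : 0 < n) {s p L B : ℝ} (hp : 1 ≤ p) (hs0 : 0 < s) (hs1 : s < 1)
    (hL : 0 ≤ L) (hB : 0 ≤ B) :
    Integrable (fun x : Euc n => (min (L * ‖x‖) B) ^ p / ‖x‖ ^ ((n : ℝ) + s * p)) volume := by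
  have : Nonempty (Fin n) := ⟨⟨0, hn⟩⟩
  have hp0 : 0 < p := by linarith
  have := integrable_fun_norm_addHaar (volume : Measure (Euc n))
    (f := fun r : ℝ => (min (L * r) B) ^ p / r ^ ((n : ℝ) + s * p))
  refine this.2 ?_
  simp only [finrank_euclideanSpace, Fintype.card_fin, smul_eq_mul]
  have hmeas : Measurable fun y : ℝ =>
      y ^ (n - 1) * ((min (L * y) B) ^ p / y ^ ((n : ℝ) + s * p)) := by fun_prop
  have hpow : ∀ y : ℝ, 0 < y → y ^ (n - 1) / y ^ ((n : ℝ) + s * p) = y ^ (-1 - s * p) := by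
    intro y hy
    rw [← Real.rpow_natCast, ← Real.rpow_sub hy, Nat.cast_sub hn]
    congr 1
    push_cast
    ring
  rw [← Ioc_union_Ioi_eq_Ioi (zero_le_one' ℝ)]
  refine IntegrableOn.union ?_ ?_
  · have h1 : IntegrableOn (fun y : ℝ => L ^ p * y ^ (p - 1 - s * p)) (Ioc 0 1) volume := by
      refine Integrable.const_mul ?_ _
      have := intervalIntegral.intervalIntegrable_rpow' (a := 0) (b := 1)
        (r := p - 1 - s * p) (by nlinarith)
      rwa [intervalIntegrable_iff_integrableOn_Ioc_of_le zero_le_one] at this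
    refine Integrable.mono' h1 hmeas.aestronglyMeasurable ?_
    refine (ae_restrict_iff' measurableSet_Ioc).2 (Filter.Eventually.of_forall fun y hy => ?_)
    have hy0 : 0 < y := hy.1
    have hm : 0 ≤ min (L * y) B := le_min (by positivity) hB
    rw [Real.norm_of_nonneg (by positivity)]
    calc y ^ (n - 1) * (min (L * y) B ^ p / y ^ ((n : ℝ) + s * p))
        = (min (L * y) B) ^ p * y ^ (-1 - s * p) := by rw [← hpow y hy0]; ring
      _ ≤ (L * y) ^ p * y ^ (-1 - s * p) := by
          gcongr
          exact min_le_left _ _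
      _ = L ^ p * y ^ (p - 1 - s * p) := by
          rw [Real.mul_rpow hL hy0.le, mul_assoc, ← Real.rpow_add hy0]
          congr 2
          ring
  · have h1 : IntegrableOn (fun y : ℝ => B ^ p * y ^ (-1 - s * p)) (Ioi 1) volume := by
      refine Integrable.const_mul ?_ _
      exact integrableOn_Ioi_rpow_of_lt (by nlinarith) one_pos
    refine Integrable.mono' h1 hmeas.aestronglyMeasurable ?_
    refine (ae_restrict_iff' measurableSet_Ioi).2 (Filter.Eventually.of_forall fun y hy => ?_)
    have hy0 : 0 < y := lt_trans one_pos hy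
    have hm : 0 ≤ min (L * y) B := le_min (by positivity) hB
    rw [Real.norm_of_nonneg (by positivity)]
    calc y ^ (n - 1) * (min (L * y) B ^ p / y ^ ((n : ℝ) + s * p))
        = (min (L * y) B) ^ p * y ^ (-1 - s * p) := by rw [← hpow y hy0]; ring
      _ ≤ B ^ p * y ^ (-1 - s * p) := by
          gcongr
          exact min_le_right _ _

lemma gagliardoIntegral_test_lt_top {n : ℕ} {s p : ℝ} (hp : 1 ≤ p) (hs0 : 0 < s) (hs1 : s < 1)
    {φ : Euc n → ℝ} (hφ : IsTest n φ) : gagliardoIntegral n s p φ < ⊤ := by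
  have hp0 : 0 < p := by linarith
  rcases Nat.eq_zero_or_pos n with rfl | hn
  · have : gagliardoIntegral 0 s p φ = 0 := by
      unfold gagliardoIntegral
      rw [← lintegral_zero (μ := (volume : Measure (Euc 0 × Euc 0)))]
      congr 1
      ext z
      rw [Subsingleton.elim z.1 z.2]
      simp [hp0]
    simp [this]
  obtain ⟨L, hL⟩ := ContDiff.lipschitzWith_of_hasCompactSupport hφ.2 hφ.1 (by simp)
  obtain ⟨M, hM⟩ := hφ.1.continuous.bounded_above_of_compact_support hφ.2
  have hM0 : 0 ≤ M := (norm_nonneg _).trans (hM 0)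
  set F : Euc n → ℝ := fun x => (min ((L : ℝ) * ‖x‖) (2 * M)) ^ p / ‖x‖ ^ ((n : ℝ) + s * p) with hF
  have hFint : Integrable F volume := integrable_profile hn hp hs0 hs1 L.2 (by positivity)
  set g : Euc n → ℝ≥0∞ := fun x => ENNReal.ofReal (F x) with hg
  have hgint : ∫⁻ x, g x < ⊤ := hFint.lintegral_lt_top
  have hgm : Measurable g := by
    simp only [hg, hF]
    fun_prop
  set K := tsupport φ
  have hK : MeasurableSet K := (isClosed_tsupport φ).measurableSet
  have hKf : volume K < ⊤ := hφ.2.isCompact.measure_lt_top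
  have hle : ∀ x y : Euc n, ‖φ x - φ y‖ₑ ^ p / ‖x - y‖ₑ ^ ((n : ℝ) + s * p) ≤ g (x - y) := by
    intro x y
    rcases eq_or_ne x y with rfl | hxy
    · simp [hp0]
    have hpos : 0 < ‖x - y‖ := norm_pos_iff.2 (sub_ne_zero.2 hxy)
    rw [← ofReal_norm, ← ofReal_norm, ENNReal.ofReal_rpow_of_nonneg (norm_nonneg _) hp0.le,
      ENNReal.ofReal_rpow_of_pos hpos, ← ENNReal.ofReal_div_of_pos (by positivity)]
    refine ENNReal.ofReal_le_ofReal ?_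
    simp only [hF]
    gcongr
    refine le_min ?_ ?_
    · simpa [dist_eq_norm] using hL.dist_le_mul x y
    · refine (norm_sub_le _ _).trans ?_
      linarith [hM x, hM y]
  have hz : ∀ z : Euc n × Euc n, ‖φ z.1 - φ z.2‖ₑ ^ p / ‖z.1 - z.2‖ₑ ^ ((n : ℝ) + s * p) ≤
      K.indicator 1 z.1 * g (z.1 - z.2) + K.indicator 1 z.2 * g (z.1 - z.2) := by
    intro z
    by_cases h1 : z.1 ∈ K
    · refine (hle _ _).trans ?_
      simp [h1]
    by_cases h2 : z.2 ∈ K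
    · refine (hle _ _).trans ?_
      simp [h2]
    · simp [image_eq_zero_of_notMem_tsupport h1, image_eq_zero_of_notMem_tsupport h2, hp0]
  have hind : Measurable (K.indicator (1 : Euc n → ℝ≥0∞)) := measurable_one.indicator hK
  unfold gagliardoIntegral
  refine (lintegral_mono hz).trans_lt ?_
  rw [lintegral_add_left (by fun_prop), Measure.volume_eq_prod]
  refine ENNReal.add_lt_top.2 ⟨?_, ?_⟩
  · rw [lintegral_prod _ (by fun_prop)]
    have : ∀ x : Euc n, ∫⁻ y, K.indicator 1 x * g (x - y) = K.indicator 1 x * ∫⁻ y, g y := by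
      intro x
      rw [lintegral_const_mul _ (by fun_prop), lintegral_sub_left_eq_self g x]
    simp only [this]
    rw [lintegral_mul_const _ hind, lintegral_indicator_one hK]
    exact ENNReal.mul_lt_top hKf hgint
  · rw [lintegral_prod_symm _ (by fun_prop)]
    have : ∀ y : Euc n, ∫⁻ x, K.indicator 1 y * g (x - y) = K.indicator 1 y * ∫⁻ x, g x := by
      intro y
      rw [lintegral_const_mul _ (by fun_prop), lintegral_sub_right_eq_self g y]
    simp only [this]
    rw [lintegral_mul_const _ hind, lintegral_indicator_one hK]
    exact ENNReal.mul_lt_top hKf hgint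

lemma isWeakGradient_test {n : ℕ} {φ : Euc n → ℝ} (hφ : IsTest n φ) :
    IsWeakGradient n φ (gradient φ) := by
  have hc : Continuous (gradient φ) := by
    unfold gradient
    exact (LinearIsometryEquiv.continuous _).comp (hφ.1.continuous_fderiv (by simp))
  refine ⟨hc.locallyIntegrable, fun ψ hψ v => ?_⟩
  have hin : ∀ x, inner ℝ (gradient φ x) v = fderiv ℝ φ x v := by
    intro x
    simp [gradient]
  simp only [hin]
  have hd : ∀ {χ : Euc n → ℝ}, IsTest n χ → Differentiable ℝ χ :=
    fun h => h.1.differentiable (by simp)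
  refine integral_mul_fderiv_eq_neg_fderiv_mul_of_integrable ?_ ?_ ?_
    (fun x _ => hd hφ x) (fun x _ => hd hψ x)
  · exact integrable_mul_test (hφ.continuous_fderiv v).locallyIntegrable hψ.1.continuous hψ.2
  · exact integrable_mul_test hφ.1.continuous.locallyIntegrable (hψ.continuous_fderiv v)
      (hψ.compact_fderiv v)
  · exact integrable_mul_test hφ.1.continuous.locallyIntegrable hψ.1.continuous hψ.2

lemma gradNorm_test_lt_top {n : ℕ} {p : ℝ} {φ : Euc n → ℝ} (hφ : IsTest n φ) :
    gradNorm n p φ < ⊤ := by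
  refine (iInf₂_le _ (isWeakGradient_test hφ)).trans_lt ?_
  have hc : Continuous (gradient φ) := by
    unfold gradient
    exact (LinearIsometryEquiv.continuous _).comp (hφ.1.continuous_fderiv (by simp))
  have hs : HasCompactSupport (gradient φ) := by
    unfold gradient
    exact (hφ.2.fderiv (𝕜 := ℝ)).comp_left (map_zero _)
  exact (hc.memLp_of_hasCompactSupport hs).eLpNorm_lt_top

/-- Test functions have finite Gagliardo-Slobodeckii seminorm. (For `s ∉ (0,1]`, which is
irrelevant, the factor `s (1 - s)` is replaced by `0`.) -/
lemma gagliardo_test_lt_top {n : ℕ} {s p : ℝ} (hp : 1 ≤ p) {φ : Euc n → ℝ} (hφ : IsTest n φ) :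
    gagliardo n s p φ < ⊤ := by
  have hp0 : 0 < p := by linarith
  unfold gagliardo
  split_ifs with hs
  · exact gradNorm_test_lt_top hφ
  · refine ENNReal.rpow_lt_top_of_nonneg (by positivity) ?_
    by_cases h : 0 < s ∧ s < 1
    · exact (ENNReal.mul_lt_top (by simp)
        (gagliardoIntegral_test_lt_top hp h.1 h.2 hφ)).ne
    · have : s * (1 - s) ≤ 0 := by
        by_contra! h'
        rcases pos_and_pos_or_neg_and_neg_of_mul_pos h' with h1 | h1
        · exact h ⟨h1.1, by linarith [h1.2]⟩
        · linarith [h1.1, h1.2]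
      simp [ENNReal.ofReal_of_nonpos this]

lemma IsTest.memLpLoc {n : ℕ} {p : ℝ} {φ : Euc n → ℝ} (hφ : IsTest n φ) : MemLpLoc n p φ :=
  ⟨hφ.1.continuous.aestronglyMeasurable,
    fun _ _ => (hφ.1.continuous.memLp_of_hasCompactSupport hφ.2).restrict _⟩

/-- `C_c^∞(ℝⁿ)` as a space of functions. -/
def testSpace (n : ℕ) : Submodule ℝ (Euc n → ℝ) where
  carrier := {φ | IsTest n φ}
  zero_mem' := ⟨contDiff_const, HasCompactSupport.zero⟩
  add_mem' := fun hu hv => ⟨hu.1.add hv.1, hu.2.add hv.2⟩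
  smul_mem' := fun _ _ hu => ⟨contDiff_const.smul hu.1, hu.2.smul_left⟩

/-- `C_c^∞(ℝⁿ)` endowed with `[·]_{W^{s,p}(ℝⁿ)}`. -/
def TestW (n : ℕ) (_s p : ℝ) (_hp : 1 ≤ p) : Type := testSpace n

instance (n : ℕ) (s p : ℝ) (hp : 1 ≤ p) : AddCommGroup (TestW n s p hp) :=
  inferInstanceAs (AddCommGroup (testSpace n))

instance (n : ℕ) (s p : ℝ) (hp : 1 ≤ p) : Module ℝ (TestW n s p hp) :=
  inferInstanceAs (Module ℝ (testSpace n))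

/-- The function underlying an element of `TestW`. -/
def TestW.toFun {n : ℕ} {s p : ℝ} {hp : 1 ≤ p} (φ : TestW n s p hp) : Euc n → ℝ :=
  Subtype.val (p := fun u => u ∈ testSpace n) φ

lemma TestW.isTest {n : ℕ} {s p : ℝ} {hp : 1 ≤ p} (φ : TestW n s p hp) : IsTest n φ.toFun :=
  Subtype.property (p := fun u => u ∈ testSpace n) φ

instance (n : ℕ) (s p : ℝ) (hp : 1 ≤ p) : SeminormedAddCommGroup (TestW n s p hp) :=
  AddGroupSeminorm.toSeminormedAddCommGroup
    { toFun := fun φ => (gagliardo n s p φ.toFun).toReal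
      map_zero' := by
        change (gagliardo n s p 0).toReal = 0
        simp [gagliardo_zero hp]
      add_le' := fun a b => gagliardo_toReal_add_le hp a.isTest.memLpLoc b.isTest.memLpLoc
        (gagliardo_test_lt_top hp a.isTest) (gagliardo_test_lt_top hp b.isTest)
      neg' := fun a => congrArg ENNReal.toReal (gagliardo_neg hp a.toFun) }

instance (n : ℕ) (s p : ℝ) (hp : 1 ≤ p) : NormedSpace ℝ (TestW n s p hp) where
  norm_smul_le := fun c a =>
    gagliardo_toReal_smul_le hp c (gagliardo_test_lt_top hp a.isTest)

lemma TestW.norm_eq {n : ℕ} {s p : ℝ} {hp : 1 ≤ p} (φ : TestW n s p hp) :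
    ‖φ‖ = (gagliardo n s p φ.toFun).toReal := rfl

/-- The homogeneous Sobolev space `𝓓^{s,p}(ℝⁿ)`: the completion of `C_c^∞(ℝⁿ)` with respect to
`[·]_{W^{s,p}(ℝⁿ)}`, a Banach space. -/
abbrev DSpace (n : ℕ) (s p : ℝ) (hp : 1 ≤ p) : Type :=
  UniformSpace.Completion (TestW n s p hp)

lemma one_le_exponent {n : ℕ} {s : ℝ} (hs : 0 < s) (hsn : s < n) : 1 ≤ (n : ℝ) / s :=
  (one_le_div hs).2 hsn.le

end HomSobolev

end

/-!
The seminorm is the `L^p` norm of a linear expression in `u`: the difference quotient on `ℝⁿ × ℝⁿ`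
if `s < 1`, the weak gradient if `s = 1`. The Poincaré inequality on balls,
`∬_{B × B} |u x - u y|^p ≤ C ρ^{n + sp} [u]^p`, shows that `[u] < ∞` forces the Campanato bound
when `s p = n`, that `[u] = 0` forces `u` to be constant, and that a Cauchy sequence, normalised to
have mean zero on the unit ball, converges in `L^p_loc`; completeness of `Ẇ^{s,p}` follows.

For the density of `C_c^∞`, mollify, then truncate smoothly, and then multiply the resulting bounded
smooth function by cutoffs with arbitrarily small seminorm. Such cutoffs exist because dilations
preserve the seminorm when `s p = n`: the average of `N` widely separated dilates of a bump has
seminorm about `N^{1/p - 1}`, which tends to `0` since `p > 1`. The isometric embedding of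
`C_c^∞` with dense range then extends to its completion.
-/

noncomputable section

open MeasureTheory Set Metric Filter Topology
open scoped ENNReal ContDiff Convolution

namespace HomSobolev

/-! ### Convergence in `L^p` -/

section Lp

variable {X E : Type*} [MeasurableSpace X] [NormedAddCommGroup E] {μ : Measure X} {p : ℝ≥0∞}

theorem eLpNorm_le_iff_lintegral_rpow_enorm_le (hp0 : p ≠ 0) (hp' : p ≠ ⊤) {f : X → E}
    {C : ℝ≥0∞} : eLpNorm f p μ ≤ C ↔ ∫⁻ x, ‖f x‖ₑ ^ p.toReal ∂μ ≤ C ^ p.toReal := by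
  rw [eLpNorm_eq_lintegral_rpow_enorm_toReal hp0 hp', one_div,
    ENNReal.rpow_inv_le_iff (ENNReal.toReal_pos hp0 hp')]

theorem enorm_integral_rpow_le {T : Type*} [MeasurableSpace T] [NormedSpace ℝ E] {ν : Measure T}
    [IsProbabilityMeasure ν] {f : T → E} (hf : AEStronglyMeasurable f ν) {r : ℝ} (hr : 1 ≤ r) :
    ‖∫ t, f t ∂ν‖ₑ ^ r ≤ ∫⁻ t, ‖f t‖ₑ ^ r ∂ν := by
  have h := eLpNorm'_le_eLpNorm'_of_exponent_le (μ := ν) one_pos hr hf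
  simp only [eLpNorm'_eq_lintegral_enorm, ENNReal.rpow_one, div_one] at h
  rw [← ENNReal.le_rpow_inv_iff (one_pos.trans_le hr), ← one_div]
  exact (enorm_integral_le_lintegral_enorm f).trans h

theorem eLpNorm_integral_le {T : Type*} [MeasurableSpace T] [NormedSpace ℝ E] {ν : Measure T}
    [IsProbabilityMeasure ν] [SFinite μ] {F : T → X → E}
    (hF : AEStronglyMeasurable (Function.uncurry F) (ν.prod μ)) (hp : 1 ≤ p) (hp' : p ≠ ⊤)
    {C : ℝ≥0∞} (hC : ∀ᵐ t ∂ν, eLpNorm (F t) p μ ≤ C) :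
    eLpNorm (fun x => ∫ t, F t x ∂ν) p μ ≤ C := by
  have hp0 : p ≠ 0 := (one_pos.trans_le hp).ne'
  have hr : 1 ≤ p.toReal := by
    rwa [← ENNReal.ofReal_le_iff_le_toReal hp', ENNReal.ofReal_one]
  have hm : ∀ᵐ x ∂μ, AEStronglyMeasurable (fun t => F t x) ν := hF.prod_swap.prodMk_left
  rw [eLpNorm_le_iff_lintegral_rpow_enorm_le hp0 hp']
  calc ∫⁻ x, ‖∫ t, F t x ∂ν‖ₑ ^ p.toReal ∂μ
      ≤ ∫⁻ x, ∫⁻ t, ‖F t x‖ₑ ^ p.toReal ∂ν ∂μ :=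
        lintegral_mono_ae (hm.mono fun x hx => enorm_integral_rpow_le hx hr)
    _ = ∫⁻ t, ∫⁻ x, ‖F t x‖ₑ ^ p.toReal ∂μ ∂ν :=
        lintegral_lintegral_swap (hF.prod_swap.enorm.pow_const _)
    _ ≤ ∫⁻ _, C ^ p.toReal ∂ν :=
        lintegral_mono_ae (hC.mono fun t ht =>
          (eLpNorm_le_iff_lintegral_rpow_enorm_le hp0 hp').1 ht)
    _ = C ^ p.toReal := by simp

theorem tendsto_eLpNorm_zero_of_dominated (hp0 : p ≠ 0) (hp' : p ≠ ⊤)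
    {F : ℕ → X → E} {g : X → ℝ} (hF : ∀ k, AEStronglyMeasurable (F k) μ) (hg : MemLp g p μ)
    (hFg : ∀ k, ∀ᵐ x ∂μ, ‖F k x‖ ≤ g x)
    (hlim : ∀ᵐ x ∂μ, Tendsto (fun k => F k x) atTop (𝓝 0)) :
    Tendsto (fun k => eLpNorm (F k) p μ) atTop (𝓝 0) := by
  have hr0 : 0 < p.toReal := ENNReal.toReal_pos hp0 hp'
  have hint : Tendsto (fun k => ∫⁻ x, ‖F k x‖ₑ ^ p.toReal ∂μ) atTop (𝓝 (∫⁻ _, 0 ∂μ)) := by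
    refine tendsto_lintegral_of_dominated_convergence' (fun x => ‖g x‖ₑ ^ p.toReal)
      (fun k => (hF k).enorm.pow_const _) (fun k => ?_)
      (lintegral_rpow_enorm_lt_top_of_eLpNorm_lt_top hp0 hp' hg.eLpNorm_lt_top).ne ?_
    · filter_upwards [hFg k] with x hx
      exact ENNReal.rpow_le_rpow (enorm_le_iff_norm_le.2 (hx.trans (le_abs_self _))) hr0.le
    · filter_upwards [hlim] with x hx
      simpa [hr0] using hx.enorm.ennrpow_const p.toReal
  simp only [eLpNorm_eq_lintegral_rpow_enorm_toReal hp0 hp']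
  simpa [hr0] using hint.ennrpow_const (1 / p.toReal)

theorem tendsto_eLpNorm_sub_of_norm_le (hp0 : p ≠ 0) (hp' : p ≠ ⊤) {f : X → E}
    (hf : MemLp f p μ) {F : ℕ → X → E} (hF : ∀ k, AEStronglyMeasurable (F k) μ)
    (hFf : ∀ k x, ‖F k x‖ ≤ ‖f x‖) (hlim : ∀ x, Tendsto (fun k => F k x) atTop (𝓝 (f x))) :
    Tendsto (fun k => eLpNorm (f - F k) p μ) atTop (𝓝 0) := by
  refine tendsto_eLpNorm_zero_of_dominated hp0 hp' (fun k => hf.1.sub (hF k))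
    (hf.norm.const_mul 2) (fun k => .of_forall fun x => ?_) (.of_forall fun x => ?_)
  · rw [two_mul]
    exact (norm_sub_le _ _).trans (add_le_add_right (hFf k x) _)
  · simpa using (hlim x).const_sub (f x)

theorem tendsto_eLpNorm_smul_sub_smul [NormedSpace ℝ E] (hp : 1 ≤ p) (hp' : p ≠ ⊤) {f : X → E}
    (hf : MemLp f p μ) {a : ℕ → X → ℝ} (ha : ∀ k, AEStronglyMeasurable (a k) μ)
    (ha1 : ∀ k x, ‖a k x‖ ≤ 1) (ha0 : ∀ x, Tendsto (fun k => a k x) atTop (𝓝 0))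
    {b : X → ℝ} (hb : AEStronglyMeasurable b μ) {M : ℝ} (hM : ∀ x, ‖b x‖ ≤ M)
    {g : ℕ → X → E} (hg : ∀ k, AEStronglyMeasurable (g k) μ)
    (hg0 : Tendsto (fun k => eLpNorm (g k) p μ) atTop (𝓝 0)) :
    Tendsto (fun k => eLpNorm (a k • f - b • g k) p μ) atTop (𝓝 0) := by
  have haf : Tendsto (fun k => eLpNorm (a k • f) p μ) atTop (𝓝 0) := by
    refine tendsto_eLpNorm_zero_of_dominated (one_pos.trans_le hp).ne' hp'
      (fun k => (ha k).smul hf.1) hf.norm (fun k => .of_forall fun x => ?_) (.of_forall fun x => ?_)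
    · rw [Pi.smul_apply', norm_smul]
      exact mul_le_of_le_one_left (norm_nonneg _) (ha1 k x)
    · simpa using (ha0 x).smul_const (f x)
  have hbg (k : ℕ) : eLpNorm (b • g k) p μ ≤ ENNReal.ofReal M * eLpNorm (g k) p μ := by
    refine eLpNorm_le_mul_eLpNorm_of_ae_le_mul (.of_forall fun x => ?_) p
    rw [Pi.smul_apply', norm_smul]
    exact mul_le_mul_of_nonneg_right (hM x) (norm_nonneg _)
  have hlim : Tendsto (fun k => eLpNorm (a k • f) p μ + ENNReal.ofReal M * eLpNorm (g k) p μ)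
      atTop (𝓝 0) := by
    simpa using haf.add (ENNReal.Tendsto.const_mul hg0 (.inr ENNReal.ofReal_ne_top))
  refine tendsto_of_tendsto_of_tendsto_of_le_of_le tendsto_const_nhds hlim (fun _ => zero_le)
    fun k => ?_
  exact (eLpNorm_sub_le ((ha k).smul hf.1) (hb.smul (hg k)) hp).trans (add_le_add_right (hbg k) _)

theorem eLpNorm_sum_le_of_pairwiseDisjoint {ι : Type*} (hp0 : p ≠ 0) (hp' : p ≠ ⊤) {s : Finset ι}
    {g : ι → X → E} (hg : ∀ i ∈ s, AEStronglyMeasurable (g i) μ)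
    (hd : (s : Set ι).PairwiseDisjoint fun i => Function.support (g i)) {B : ℝ≥0∞}
    (hB : ∀ i ∈ s, eLpNorm (g i) p μ ≤ B) :
    eLpNorm (∑ i ∈ s, g i) p μ ≤ (s.card : ℝ≥0∞) ^ (1 / p.toReal) * B := by
  have hq : 0 < p.toReal := ENNReal.toReal_pos hp0 hp'
  have hpt (z : X) : ‖(∑ i ∈ s, g i) z‖ₑ ^ p.toReal ≤ ∑ i ∈ s, ‖g i z‖ₑ ^ p.toReal := by
    rw [Finset.sum_apply]
    by_cases h : ∃ i ∈ s, g i z ≠ 0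
    · obtain ⟨i, hi, hiz⟩ := h
      rw [Finset.sum_eq_single_of_mem i hi fun j hj hji => by
        by_contra hjz
        exact disjoint_left.1 (hd hj hi hji) hjz hiz]
      exact Finset.single_le_sum (f := fun j => ‖g j z‖ₑ ^ p.toReal) (fun _ _ => zero_le) hi
    · push Not at h
      rw [Finset.sum_eq_zero h]
      simp [hq]
  rw [eLpNorm_le_iff_lintegral_rpow_enorm_le hp0 hp', ENNReal.mul_rpow_of_nonneg _ _ hq.le,
    one_div, ENNReal.rpow_inv_rpow hq.ne']
  calc ∫⁻ z, ‖(∑ i ∈ s, g i) z‖ₑ ^ p.toReal ∂μ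
      ≤ ∫⁻ z, ∑ i ∈ s, ‖g i z‖ₑ ^ p.toReal ∂μ := lintegral_mono hpt
    _ = ∑ i ∈ s, ∫⁻ z, ‖g i z‖ₑ ^ p.toReal ∂μ :=
        lintegral_finsetSum' _ fun i hi => (hg i hi).enorm.pow_const _
    _ ≤ ∑ _ ∈ s, B ^ p.toReal := Finset.sum_le_sum fun i hi =>
        (eLpNorm_le_iff_lintegral_rpow_enorm_le hp0 hp').1 (hB i hi)
    _ = s.card * B ^ p.toReal := by simp

end Lp

theorem tendsto_eLpNorm_sub_translate {X E : Type*} [NormedAddCommGroup X] [NormedSpace ℝ X]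
    [FiniteDimensional ℝ X] [MeasurableSpace X] [BorelSpace X] [NormedAddCommGroup E]
    {μ : Measure X} [μ.IsAddHaarMeasure] {p : ℝ≥0∞} (hp : 1 ≤ p) (hp' : p ≠ ⊤)
    {f : X → E} (hf : MemLp f p μ) :
    Tendsto (fun h : X => eLpNorm (fun z => f z - f (z - h)) p μ) (𝓝 0) (𝓝 0) := by
  have : ProperSpace X := FiniteDimensional.proper_real X
  have : Fact (1 ≤ p) := ⟨hp⟩
  let g : X → C(X, X) := fun h => ⟨fun z => z - h, by fun_prop⟩
  have hg : Continuous g :=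
    ContinuousMap.continuous_of_continuous_uncurry _ (continuous_snd.sub continuous_fst)
  have hgm : ∀ h, MeasurePreserving (g h) μ μ := fun h => measurePreserving_sub_right μ h
  have hae (h : X) : Lp.compMeasurePreserving (g h) (hgm h) (hf.toLp f) =ᵐ[μ]
      fun z => f (z - h) := by
    filter_upwards [Lp.coeFn_compMeasurePreserving (hf.toLp f) (hgm h),
      (hgm h).quasiMeasurePreserving.ae_eq_comp hf.coeFn_toLp] with z hz hfz
    rw [hz, hfz]
    rfl
  have hlim := tendsto_iff_edist_tendsto_0.1 <|
    (tendsto_const_nhds (x := hf.toLp f)).compMeasurePreservingLp (hg.tendsto 0) hgm (hgm 0) hp'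
  refine hlim.congr fun h => ?_
  rw [Lp.edist_def, ← eLpNorm_neg]
  refine eLpNorm_congr_ae ?_
  filter_upwards [hae h, hae 0] with z hz hz₀
  simp only [Pi.neg_apply, Pi.sub_apply, hz, hz₀, sub_zero, neg_sub]

/-! ### Averages of dilations -/

/-- The dilation `z ↦ r ^ (-d / q) f (z / r)`, normalized to be an isometry of `L^q` in
dimension `d`. -/
def dilate {X E : Type*} [NormedAddCommGroup X] [NormedSpace ℝ X] [NormedAddCommGroup E]
    [NormedSpace ℝ E] (q r : ℝ) (f : X → E) : X → E :=
  fun z => r ^ (-((Module.finrank ℝ X : ℝ) / q)) • f (r⁻¹ • z)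

/-- The average of the `L^q`-normalized dilations of `f` by `r 0, …, r (N - 1)`; it is `0` if
`N = 0`. -/
def dilationAverage {X E : Type*} [NormedAddCommGroup X] [NormedSpace ℝ X] [NormedAddCommGroup E]
    [NormedSpace ℝ E] (q : ℝ) (N : ℕ) (r : ℕ → ℝ) (f : X → E) : X → E :=
  (N : ℝ)⁻¹ • ∑ j ∈ Finset.range N, dilate q (r j) f

/-- The annulus with radii `a⁻¹` and `a`, boundary included. -/
def annulus (X : Type*) [Norm X] (a : ℝ) : Set X := {z | a⁻¹ ≤ ‖z‖ ∧ ‖z‖ ≤ a}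

theorem measurableSet_annulus {X : Type*} [NormedAddCommGroup X] [MeasurableSpace X]
    [OpensMeasurableSpace X] (a : ℝ) : MeasurableSet (annulus X a) :=
  (measurableSet_le measurable_const measurable_norm).inter
    (measurableSet_le measurable_norm measurable_const)

theorem tendsto_eLpNorm_indicator_compl_annulus {X E : Type*} [NormedAddCommGroup X]
    [MeasurableSpace X] [OpensMeasurableSpace X] [NormedAddCommGroup E] {μ : Measure X}
    [NullSingletonClass μ] {p : ℝ≥0∞} (hp0 : p ≠ 0) (hp' : p ≠ ⊤) {f : X → E} (hf : MemLp f p μ) :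
    Tendsto (fun m : ℕ => eLpNorm ((annulus X (m + 1))ᶜ.indicator f) p μ) atTop (𝓝 0) := by
  refine tendsto_eLpNorm_zero_of_dominated hp0 hp'
    (fun m => hf.1.indicator (measurableSet_annulus _).compl) hf.norm
    (fun m => .of_forall fun z => norm_indicator_le_norm_self _ _) ?_
  have hne : ∀ᵐ z ∂μ, z ≠ 0 := by simp [ae_iff]
  filter_upwards [hne] with z hz
  have hz' : 0 < ‖z‖ := norm_pos_iff.2 hz
  refine tendsto_const_nhds.congr' ?_
  filter_upwards [tendsto_natCast_atTop_atTop.eventually_ge_atTop (max ‖z‖ ‖z‖⁻¹)] with m hm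
  have hlow : ‖z‖⁻¹ ≤ (m : ℝ) + 1 := (le_max_right _ _).trans (hm.trans (by linarith))
  have hup : ‖z‖ ≤ (m : ℝ) + 1 := (le_max_left _ _).trans (hm.trans (by linarith))
  have hmem : z ∈ annulus X ((m : ℝ) + 1) := ⟨inv_le_of_inv_le₀ hz' hlow, hup⟩
  exact (indicator_of_notMem (notMem_compl_iff.2 hmem) f).symm

theorem eLpNorm_comp_inv_smul {X E : Type*} [NormedAddCommGroup X] [NormedSpace ℝ X]
    [FiniteDimensional ℝ X] [MeasurableSpace X] [BorelSpace X] {μ : Measure X} [μ.IsAddHaarMeasure]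
    [NormedAddCommGroup E] {p : ℝ≥0∞} (hp' : p ≠ ⊤) {r : ℝ} (hr : 0 < r) {f : X → E}
    (hf : AEStronglyMeasurable f μ) :
    eLpNorm (fun z => f (r⁻¹ • z)) p μ =
      ENNReal.ofReal (r ^ ((Module.finrank ℝ X : ℝ) / p.toReal)) * eLpNorm f p μ := by
  have hmap := Measure.map_addHaar_smul μ (inv_ne_zero hr.ne')
  have hf' : AEStronglyMeasurable f (Measure.map (r⁻¹ • ·) μ) := hmap ▸ hf.smul_measure _
  have h := eLpNorm_map_measure (p := p) hf' (measurable_const_smul r⁻¹).aemeasurable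
  rw [hmap, eLpNorm_smul_measure_of_ne_top hp', inv_pow, inv_inv, abs_of_pos (by positivity),
    ENNReal.ofReal_rpow_of_nonneg (by positivity) (by simp), ← Real.rpow_natCast,
    ← Real.rpow_mul hr.le, ENNReal.toReal_div, ENNReal.toReal_one, mul_one_div] at h
  exact h.symm

section dilate

variable {X E : Type*} [NormedAddCommGroup X] [NormedSpace ℝ X] [NormedAddCommGroup E]
  [NormedSpace ℝ E]

theorem dilate_add (q r : ℝ) (f g : X → E) : dilate q r (f + g) = dilate q r f + dilate q r g := by
  ext z
  simp only [dilate, Pi.add_apply, smul_add]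

theorem dilationAverage_add (q : ℝ) (N : ℕ) (r : ℕ → ℝ) (f g : X → E) :
    dilationAverage q N r (f + g) = dilationAverage q N r f + dilationAverage q N r g := by
  simp only [dilationAverage, dilate_add, Finset.sum_add_distrib, smul_add]

theorem norm_mem_Icc_of_dilate_indicator_annulus_ne_zero {q r a : ℝ} (hr : 0 < r)
    {f : X → E} {z : X} (hz : dilate q r ((annulus X a).indicator f) z ≠ 0) :
    ‖z‖ ∈ Icc (r / a) (a * r) := by
  have hmem : r⁻¹ • z ∈ annulus X a := by
    by_contra h
    exact hz (by rw [dilate, indicator_of_notMem h, smul_zero])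
  obtain ⟨hlow, hup⟩ := hmem
  rw [norm_smul, norm_inv, Real.norm_of_nonneg hr.le, inv_mul_eq_div] at hlow hup
  rw [le_div_iff₀ hr, inv_mul_eq_div] at hlow
  exact ⟨hlow, (div_le_iff₀ hr).1 hup⟩

theorem pairwise_disjoint_support_dilate_indicator_annulus {q a : ℝ} (ha : 0 < a) {r : ℕ → ℝ}
    (hr : ∀ j, 0 < r j) (hsep : ∀ i j, i < j → a ^ 2 * r i < r j) (f : X → E) :
    Pairwise (Function.onFun Disjoint fun j =>
      Function.support (dilate q (r j) ((annulus X a).indicator f))) := by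
  refine (symm_disjoint.comap _).pairwise_on _ |>.2 fun i j hij => ?_
  refine disjoint_left.2 fun z hzi hzj => ?_
  have hi := (norm_mem_Icc_of_dilate_indicator_annulus_ne_zero (hr i) hzi).2
  have hj := (norm_mem_Icc_of_dilate_indicator_annulus_ne_zero (hr j) hzj).1
  rw [div_le_iff₀ ha] at hj
  refine (hsep i j hij).not_ge ?_
  calc r j ≤ ‖z‖ * a := hj
    _ ≤ a * r i * a := by gcongr
    _ = a ^ 2 * r i := by ring

theorem exists_separated_radii (K : ℝ) {b : ℝ} (hb : 0 ≤ b) :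
    ∃ r : ℕ → ℝ, (∀ j, 0 < r j) ∧ (∀ j, K ≤ r j) ∧ ∀ i j, i < j → b * r i < r j := by
  refine ⟨fun j => (|K| + 1) * (b + 1) ^ j, fun j => by positivity, fun j => ?_, fun i j hij => ?_⟩
  · calc K ≤ |K| + 1 := (le_abs_self K).trans (le_add_of_nonneg_right zero_le_one)
      _ ≤ (|K| + 1) * (b + 1) ^ j :=
        le_mul_of_one_le_right (by positivity) (one_le_pow₀ (by linarith))
  · calc b * ((|K| + 1) * (b + 1) ^ i) < (b + 1) * ((|K| + 1) * (b + 1) ^ i) := by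
          gcongr
          linarith
      _ = (|K| + 1) * (b + 1) ^ (i + 1) := by ring
      _ ≤ (|K| + 1) * (b + 1) ^ j := by
          gcongr
          · linarith
          · exact hij

variable [FiniteDimensional ℝ X] [MeasurableSpace X] [BorelSpace X] {μ : Measure X}
  [μ.IsAddHaarMeasure] {p : ℝ≥0∞}

theorem aestronglyMeasurable_dilate (q : ℝ) {r : ℝ} (hr : 0 < r) {f : X → E}
    (hf : AEStronglyMeasurable f μ) : AEStronglyMeasurable (dilate q r f) μ :=
  (hf.comp_quasiMeasurePreserving
    (Measure.quasiMeasurePreserving_smul μ (inv_ne_zero hr.ne'))).const_smul _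

theorem aestronglyMeasurable_dilationAverage (q : ℝ) (N : ℕ) {r : ℕ → ℝ} (hr : ∀ j, 0 < r j)
    {f : X → E} (hf : AEStronglyMeasurable f μ) :
    AEStronglyMeasurable (dilationAverage q N r f) μ :=
  (Finset.aestronglyMeasurable_sum _ fun j _ =>
    aestronglyMeasurable_dilate q (hr j) hf).const_smul _

theorem eLpNorm_dilate (hp' : p ≠ ⊤) {r : ℝ} (hr : 0 < r) {f : X → E}
    (hf : AEStronglyMeasurable f μ) : eLpNorm (dilate p.toReal r f) p μ = eLpNorm f p μ := by
  set d : ℝ := Module.finrank ℝ X / p.toReal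
  calc eLpNorm (dilate p.toReal r f) p μ
      = ‖r ^ (-d)‖ₑ * eLpNorm (fun z => f (r⁻¹ • z)) p μ := eLpNorm_const_smul _ _ _ _
    _ = ENNReal.ofReal (r ^ (-d) * r ^ d) * eLpNorm f p μ := by
        rw [eLpNorm_comp_inv_smul hp' hr hf, ← mul_assoc, Real.enorm_of_nonneg (by positivity),
          ENNReal.ofReal_mul (by positivity)]
    _ = eLpNorm f p μ := by
        rw [← Real.rpow_add hr, neg_add_cancel, Real.rpow_zero, ENNReal.ofReal_one, one_mul]

theorem eLpNorm_dilationAverage_le (hp : 1 ≤ p) (hp' : p ≠ ⊤) (N : ℕ) {r : ℕ → ℝ}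
    (hr : ∀ j, 0 < r j) {f : X → E} (hf : AEStronglyMeasurable f μ) :
    eLpNorm (dilationAverage p.toReal N r f) p μ ≤ eLpNorm f p μ := by
  rw [dilationAverage, eLpNorm_const_smul, Real.enorm_of_nonneg (by positivity)]
  have hsum : eLpNorm (∑ j ∈ Finset.range N, dilate p.toReal (r j) f) p μ ≤ N * eLpNorm f p μ := by
    refine (eLpNorm_sum_le (fun j _ => aestronglyMeasurable_dilate _ (hr j) hf) hp).trans_eq ?_
    simp only [eLpNorm_dilate hp' (hr _) hf, Finset.sum_const, Finset.card_range, nsmul_eq_mul]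
  calc ENNReal.ofReal (N : ℝ)⁻¹ * eLpNorm (∑ j ∈ Finset.range N, dilate p.toReal (r j) f) p μ
      ≤ ENNReal.ofReal (N : ℝ)⁻¹ * (N * eLpNorm f p μ) := by gcongr
    _ = ENNReal.ofReal ((N : ℝ)⁻¹ * N) * eLpNorm f p μ := by
        rw [ENNReal.ofReal_mul (by positivity), ENNReal.ofReal_natCast, mul_assoc]
    _ ≤ eLpNorm f p μ :=
        mul_le_of_le_one_left' (ENNReal.ofReal_le_one.2 inv_mul_le_one)

theorem eLpNorm_dilationAverage_le_of_pairwise_disjoint (hp0 : p ≠ 0) (hp' : p ≠ ⊤) {N : ℕ}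
    (hN : 0 < N) {r : ℕ → ℝ} (hr : ∀ j, 0 < r j) {f : X → E} (hf : AEStronglyMeasurable f μ)
    (hd : Pairwise (Function.onFun Disjoint fun j =>
      Function.support (dilate p.toReal (r j) f))) :
    eLpNorm (dilationAverage p.toReal N r f) p μ ≤
      ENNReal.ofReal ((N : ℝ) ^ (1 / p.toReal - 1)) * eLpNorm f p μ := by
  have hNr : (0 : ℝ) < N := by exact_mod_cast hN
  have hsum := eLpNorm_sum_le_of_pairwiseDisjoint (s := Finset.range N) hp0 hp'
    (fun j _ => aestronglyMeasurable_dilate (μ := μ) p.toReal (hr j) hf) (hd.set_pairwise _)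
    fun j _ => (eLpNorm_dilate hp' (hr j) hf).le
  rw [dilationAverage, eLpNorm_const_smul, Real.enorm_of_nonneg (by positivity)]
  refine (mul_le_mul_right hsum _).trans_eq ?_
  rw [← mul_assoc, Finset.card_range, ← ENNReal.ofReal_natCast, ENNReal.ofReal_rpow_of_pos hNr,
    ← ENNReal.ofReal_mul (by positivity), Real.rpow_sub_one hNr.ne', inv_mul_eq_div]

theorem tendsto_natCast_rpow_one_div_toReal_sub_one_mul (hp : 1 < p) (hp' : p ≠ ⊤) {A : ℝ≥0∞}
    (hA : A ≠ ⊤) :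
    Tendsto (fun N : ℕ => ENNReal.ofReal ((N : ℝ) ^ (1 / p.toReal - 1)) * A) atTop (𝓝 0) := by
  have hq : 1 < p.toReal := by
    simpa using (ENNReal.toReal_lt_toReal ENNReal.one_ne_top hp').2 hp
  have hexp : 0 < 1 - 1 / p.toReal := by
    rwa [sub_pos, div_lt_one (one_pos.trans hq)]
  have h := (tendsto_rpow_neg_atTop hexp).comp (tendsto_natCast_atTop_atTop (R := ℝ))
  simpa [Function.comp_def] using
    ENNReal.Tendsto.mul_const (ENNReal.tendsto_ofReal h) (.inr hA)

theorem exists_eLpNorm_dilationAverage_le [Nontrivial X] (hp : 1 < p) (hp' : p ≠ ⊤) {f : X → E}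
    (hf : MemLp f p μ) (K : ℝ) {ε : ℝ≥0∞} (hε : ε ≠ 0) :
    ∃ (N : ℕ) (r : ℕ → ℝ), 0 < N ∧ (∀ j, 0 < r j) ∧ (∀ j, K ≤ r j) ∧
      eLpNorm (dilationAverage p.toReal N r f) p μ ≤ ε := by
  have hp0 : p ≠ 0 := (one_pos.trans hp).ne'
  have hε2 : 0 < ε / 2 := ENNReal.half_pos hε
  obtain ⟨m, hm⟩ := ((tendsto_eLpNorm_indicator_compl_annulus hp0 hp' hf).eventually_le_const
    hε2).exists
  set A := annulus X ((m : ℝ) + 1)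
  have hA : MeasurableSet A := measurableSet_annulus _
  obtain ⟨N, hN, hN0⟩ := (((tendsto_natCast_rpow_one_div_toReal_sub_one_mul hp hp'
    hf.eLpNorm_lt_top.ne).eventually_le_const hε2).and (eventually_gt_atTop 0)).exists
  obtain ⟨r, hr, hrK, hsep⟩ := exists_separated_radii K (sq_nonneg ((m : ℝ) + 1))
  have hnear : eLpNorm (dilationAverage p.toReal N r (A.indicator f)) p μ ≤ ε / 2 := by
    refine (eLpNorm_dilationAverage_le_of_pairwise_disjoint hp0 hp' hN0 hr (hf.1.indicator hA)
      (pairwise_disjoint_support_dilate_indicator_annulus (by positivity) hr hsep f)).trans ?_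
    exact (mul_le_mul_right (eLpNorm_indicator_le f) _).trans hN
  have hfar : eLpNorm (dilationAverage p.toReal N r (Aᶜ.indicator f)) p μ ≤ ε / 2 :=
    (eLpNorm_dilationAverage_le hp.le hp' N hr (hf.1.indicator hA.compl)).trans hm
  refine ⟨N, r, hN0, hr, hrK, ?_⟩
  rw [← indicator_self_add_compl A f, dilationAverage_add, ← ENNReal.add_halves ε]
  exact (eLpNorm_add_le
    (aestronglyMeasurable_dilationAverage _ N hr (hf.1.indicator hA))
    (aestronglyMeasurable_dilationAverage _ N hr (hf.1.indicator hA.compl)) hp.le).trans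
    (add_le_add hnear hfar)

end dilate

/-! ### Mollification -/

/-- A bump function around the origin whose support shrinks to a point as `k → ∞`. -/
def bump (n k : ℕ) : ContDiffBump (0 : Euc n) where
  rIn := ((k : ℝ) + 1)⁻¹ / 2
  rOut := ((k : ℝ) + 1)⁻¹
  rIn_pos := by positivity
  rIn_lt_rOut := half_lt_self (by positivity)

/-- The probability measure on `ℝⁿ` whose density is the normalized bump function. -/
def bumpMeasure (n k : ℕ) : Measure (Euc n) :=
  volume.withDensity fun t => ENNReal.ofReal ((bump n k).normed volume t)

/-- The mollification of `u`: its convolution with `bumpMeasure n k`. -/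
def moll {n : ℕ} {E : Type*} [NormedAddCommGroup E] [NormedSpace ℝ E] (k : ℕ) (u : Euc n → E) :
    Euc n → E := fun x => ∫ t, u (x - t) ∂bumpMeasure n k

theorem tendsto_bump_rOut (n : ℕ) : Tendsto (fun k => (bump n k).rOut) atTop (𝓝 0) :=
  tendsto_inv_atTop_zero.comp (tendsto_atTop_add_const_right _ _ tendsto_natCast_atTop_atTop)

theorem measurable_bump_density (n k : ℕ) :
    Measurable fun t => ENNReal.ofReal ((bump n k).normed volume t) :=
  (bump n k).continuous_normed.measurable.ennreal_ofReal

instance (n k : ℕ) : IsProbabilityMeasure (bumpMeasure n k) := by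
  constructor
  rw [bumpMeasure, withDensity_apply _ MeasurableSet.univ, Measure.restrict_univ,
    ← ofReal_integral_eq_lintegral_ofReal (bump n k).integrable_normed
      (.of_forall (bump n k).nonneg_normed), (bump n k).integral_normed, ENNReal.ofReal_one]

theorem ae_bumpMeasure_norm_lt (n k : ℕ) : ∀ᵐ t ∂bumpMeasure n k, ‖t‖ < (bump n k).rOut := by
  rw [bumpMeasure, ae_withDensity_iff (measurable_bump_density n k)]
  refine .of_forall fun t ht => ?_
  have hmem : t ∈ Function.support ((bump n k).normed volume) := fun h0 =>
    ht (by rw [h0, ENNReal.ofReal_zero])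
  rwa [(bump n k).support_normed_eq, mem_ball_zero_iff] at hmem

theorem isTest_bump_sub (n k : ℕ) (x : Euc n) :
    IsTest n fun t => (bump n k).normed volume (x - t) :=
  ⟨(bump n k).contDiff_normed.comp (contDiff_const.sub contDiff_id),
    (bump n k).hasCompactSupport_normed.comp_homeomorph (Homeomorph.subLeft x)⟩

theorem inner_gradient {X : Type*} [NormedAddCommGroup X] [InnerProductSpace ℝ X] [CompleteSpace X]
    (f : X → ℝ) (x v : X) : inner ℝ (gradient f x) v = fderiv ℝ f x v := by
  simp only [gradient, InnerProductSpace.toDual_symm_apply]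

theorem fderiv_comp_const_sub {X E : Type*} [NormedAddCommGroup X] [NormedSpace ℝ X]
    [NormedAddCommGroup E] [NormedSpace ℝ E] {f : X → E} {x t : X}
    (hf : DifferentiableAt ℝ f (x - t)) :
    fderiv ℝ (fun y => f (x - y)) t = -fderiv ℝ f (x - t) := by
  rw [fderiv_fun_comp t hf (by fun_prop), fderiv_const_sub, fderiv_fun_id,
    ContinuousLinearMap.comp_neg, ContinuousLinearMap.comp_id]

section moll

variable {n k : ℕ} {E : Type*} [NormedAddCommGroup E]

theorem locallyIntegrable_sub_left {u : Euc n → E} (hu : LocallyIntegrable u volume) (x : Euc n) :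
    LocallyIntegrable (fun t => u (x - t)) volume := by
  refine locallyIntegrable_iff.2 fun K hK => ?_
  have himage : IntegrableOn u ((fun t => x - t) '' K) :=
    locallyIntegrable_iff.1 hu _ (hK.image (by fun_prop))
  have h := ((Measure.measurePreserving_sub_left volume x).integrableOn_comp_preimage
    (Homeomorph.subLeft x).measurableEmbedding).2 himage
  rwa [preimage_image_eq _ sub_right_injective] at h

variable [NormedSpace ℝ E]

theorem integral_bumpMeasure (g : Euc n → E) :
    ∫ t, g t ∂bumpMeasure n k = ∫ t, (bump n k).normed volume t • g t := by
  rw [bumpMeasure, integral_withDensity_eq_integral_toReal_smul (measurable_bump_density n k)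
    (.of_forall fun _ => ENNReal.ofReal_lt_top)]
  simp only [ENNReal.toReal_ofReal ((bump n k).nonneg_normed _)]

theorem integrable_bumpMeasure_iff {g : Euc n → E} :
    Integrable g (bumpMeasure n k) ↔
      Integrable (fun t => (bump n k).normed volume t • g t) volume := by
  rw [bumpMeasure, integrable_withDensity_iff_integrable_smul' (measurable_bump_density n k)
    (.of_forall fun _ => ENNReal.ofReal_lt_top)]
  simp only [ENNReal.toReal_ofReal ((bump n k).nonneg_normed _)]

theorem integrable_sub_bumpMeasure {u : Euc n → E} (hu : LocallyIntegrable u volume)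
    (x : Euc n) : Integrable (fun t => u (x - t)) (bumpMeasure n k) :=
  integrable_bumpMeasure_iff.2 <|
    (locallyIntegrable_sub_left hu x).integrable_smul_left_of_hasCompactSupport
      (bump n k).continuous_normed (bump n k).hasCompactSupport_normed

theorem moll_eq_convolution (u : Euc n → E) :
    moll k u = (bump n k).normed volume ⋆[ContinuousLinearMap.lsmul ℝ ℝ, volume] u :=
  funext fun _ => integral_bumpMeasure _

theorem moll_eq_integral (u : Euc n → E) (x : Euc n) :
    moll k u x = ∫ t, (bump n k).normed volume (x - t) • u t := by
  rw [moll, integral_bumpMeasure, ← integral_sub_left_eq_self _ _ x]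
  simp only [sub_sub_cancel]

theorem contDiff_moll {u : Euc n → E} (hu : LocallyIntegrable u volume) :
    ContDiff ℝ ∞ (moll k u) := by
  rw [moll_eq_convolution]
  exact (bump n k).hasCompactSupport_normed.contDiff_convolution_left _
    (bump n k).contDiff_normed hu

theorem ae_tendsto_moll [CompleteSpace E] {u : Euc n → E} (hu : LocallyIntegrable u volume) :
    ∀ᵐ x, Tendsto (fun k => moll k u x) atTop (𝓝 (u x)) := by
  simp only [moll_eq_convolution]
  refine ContDiffBump.ae_convolution_tendsto_right_of_locallyIntegrable (K := 2)
    (tendsto_bump_rOut n) (.of_forall fun k => ?_) hu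
  exact (mul_div_cancel₀ ((k : ℝ) + 1)⁻¹ two_ne_zero).ge

theorem fderiv_moll_apply {u : Euc n → ℝ} (hu : LocallyIntegrable u volume) (x v : Euc n) :
    fderiv ℝ (moll k u) x v = ∫ t, u t * fderiv ℝ ((bump n k).normed volume) (x - t) v := by
  have hρ : ContDiff ℝ 1 ((bump n k).normed (volume : Measure (Euc n))) :=
    (bump n k).contDiff_normed
  have hρc : HasCompactSupport ((bump n k).normed (volume : Measure (Euc n))) :=
    (bump n k).hasCompactSupport_normed
  have hconv : moll k u =
      u ⋆[ContinuousLinearMap.mul ℝ ℝ, volume] (bump n k).normed volume := by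
    ext y
    simp only [moll_eq_integral, convolution_def, ContinuousLinearMap.mul_apply', smul_eq_mul,
      mul_comm]
  rw [hconv, (hρc.hasFDerivAt_convolution_right (ContinuousLinearMap.mul ℝ ℝ) hu hρ x).fderiv,
    convolution_precompR_apply _ hu (hρc.fderiv (𝕜 := ℝ)) (hρ.continuous_fderiv one_ne_zero)]
  rfl

theorem gradient_moll {u : Euc n → ℝ} {G : Euc n → Euc n} (hu : LocallyIntegrable u volume)
    (hG : IsWeakGradient n u G) : gradient (moll k u) = moll k G := by
  ext1 x
  refine ext_inner_right ℝ fun v => ?_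
  have htest := isTest_bump_sub n k x
  have hparts := hG.2 _ htest v
  have hfderiv (t : Euc n) : fderiv ℝ (fun y => (bump n k).normed volume (x - y)) t v =
      -fderiv ℝ ((bump n k).normed volume) (x - t) v := by
    rw [fderiv_comp_const_sub ((bump n k).contDiff_normed.differentiable one_ne_zero _),
      neg_apply]
  have hint : Integrable fun t => (bump n k).normed volume (x - t) • G t :=
    hG.1.integrable_smul_left_of_hasCompactSupport htest.1.continuous htest.2
  calc inner ℝ (gradient (moll k u) x) v
      = ∫ t, u t * fderiv ℝ ((bump n k).normed volume) (x - t) v := by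
        rw [inner_gradient, fderiv_moll_apply hu]
    _ = ∫ t, inner ℝ (G t) v * (bump n k).normed volume (x - t) := by
        simpa only [hfderiv, mul_neg, integral_neg, neg_inj] using hparts
    _ = inner ℝ (moll k G x) v := by
        rw [moll_eq_integral, real_inner_comm, ← integral_inner hint]
        simp only [real_inner_smul_right, real_inner_comm, mul_comm]

theorem tendsto_eLpNorm_integral_sub_translate {X : Type*} [NormedAddCommGroup X]
    [NormedSpace ℝ X] [FiniteDimensional ℝ X] [MeasurableSpace X] [BorelSpace X] {μ : Measure X}
    [μ.IsAddHaarMeasure] {p : ℝ≥0∞} (hp : 1 ≤ p) (hp' : p ≠ ⊤) {f : X → E}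
    (hf : MemLp f p μ) {a : Euc n → X} (ha : Continuous a) (ha0 : a 0 = 0) :
    Tendsto (fun k => eLpNorm (fun z => ∫ t, (f z - f (z - a t)) ∂bumpMeasure n k) p μ) atTop
      (𝓝 0) := by
  have hshift : Tendsto (fun t => eLpNorm (fun z => f z - f (z - a t)) p μ) (𝓝 0) (𝓝 0) :=
    (tendsto_eLpNorm_sub_translate hp hp' hf).comp (ha0 ▸ ha.tendsto 0)
  refine ENNReal.tendsto_nhds_zero.2 fun ε hε => ?_
  obtain ⟨δ, hδ, hclose⟩ :=
    Metric.eventually_nhds_iff.1 (ENNReal.tendsto_nhds_zero.1 hshift ε hε)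
  filter_upwards [(tendsto_bump_rOut n).eventually_lt_const hδ] with k hk
  refine eLpNorm_integral_le (F := fun t z => f z - f (z - a t)) ?_ hp hp' ?_
  · have : ProperSpace X := FiniteDimensional.proper_real X
    have hsub : Measure.QuasiMeasurePreserving (fun z : Euc n × X => z.2 - a z.1)
        ((bumpMeasure n k).prod μ) μ :=
      QuasiMeasurePreserving.prod_of_right (measurable_snd.sub (ha.measurable.comp measurable_fst))
        (.of_forall fun t => (measurePreserving_sub_right μ (a t)).quasiMeasurePreserving)
    exact hf.1.comp_snd.sub (hf.1.comp_quasiMeasurePreserving hsub)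
  · filter_upwards [ae_bumpMeasure_norm_lt n k] with t ht
    exact hclose (by simpa only [dist_zero_right] using ht.trans hk)

theorem eLpNorm_moll_le {p : ℝ≥0∞} (hp : 1 ≤ p) (hp' : p ≠ ⊤) {f : Euc n → E}
    (hf : AEStronglyMeasurable f volume) : eLpNorm (moll k f) p volume ≤ eLpNorm f p volume := by
  refine eLpNorm_integral_le (F := fun t z => f (z - t)) ?_ hp hp' (.of_forall fun t => ?_)
  · have hsub : AEStronglyMeasurable (fun z : Euc n × Euc n => f (z.2 - z.1))
        (volume.prod volume) :=
      hf.comp_quasiMeasurePreserving ((quasiMeasurePreserving_sub volume volume).comp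
        Measure.measurePreserving_swap.quasiMeasurePreserving)
    exact hsub.mono_ac ((withDensity_absolutelyContinuous _ _).prod .rfl)
  · exact (eLpNorm_comp_measurePreserving hf (measurePreserving_sub_right volume t)).le

end moll

/-! ### The seminorm as an `L^p` norm -/

/-- The weighted difference quotient of `u` on `ℝⁿ × ℝⁿ`; for `0 < s < 1` its `L^p` norm is the
Gagliardo-Slobodeckii seminorm. -/
def diffQuot (n : ℕ) (s p : ℝ) (u : Euc n → ℝ) : Euc n × Euc n → ℝ :=
  fun z => (s * (1 - s)) ^ (1 / p) * ‖z.1 - z.2‖ ^ (-(((n : ℝ) + s * p) / p)) * (u z.1 - u z.2)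

section diffQuot

variable {n : ℕ} {s p : ℝ}

theorem enorm_diffQuot_rpow (hp : 0 < p) (hs0 : 0 ≤ s) (hs1 : s ≤ 1) (u : Euc n → ℝ)
    (z : Euc n × Euc n) :
    ‖diffQuot n s p u z‖ₑ ^ p =
      ENNReal.ofReal (s * (1 - s)) * (‖u z.1 - u z.2‖ₑ ^ p / ‖z.1 - z.2‖ₑ ^ ((n : ℝ) + s * p)) := by
  have hs : 0 ≤ s * (1 - s) := mul_nonneg hs0 (sub_nonneg.2 hs1)
  rcases eq_or_ne z.1 z.2 with h | h
  · simp [diffQuot, h, hp]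
  have hz : 0 < ‖z.1 - z.2‖ := norm_pos_iff.2 (sub_ne_zero.2 h)
  have hweight : (‖z.1 - z.2‖ ^ (-(((n : ℝ) + s * p) / p))) ^ p =
      (‖z.1 - z.2‖ ^ ((n : ℝ) + s * p))⁻¹ := by
    rw [← Real.rpow_mul hz.le, neg_mul, div_mul_cancel₀ _ hp.ne', Real.rpow_neg hz.le]
  have hconst : ((s * (1 - s)) ^ (1 / p)) ^ p = s * (1 - s) := by
    rw [← Real.rpow_mul hs, one_div_mul_cancel hp.ne', Real.rpow_one]
  rw [diffQuot, enorm_mul, ENNReal.mul_rpow_of_nonneg _ _ hp.le,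
    Real.enorm_of_nonneg (by positivity), ENNReal.ofReal_rpow_of_nonneg (by positivity) hp.le,
    Real.mul_rpow (by positivity) (by positivity), hconst, hweight, ENNReal.ofReal_mul hs,
    ENNReal.ofReal_inv_of_pos (by positivity), ← ENNReal.ofReal_rpow_of_pos hz, ofReal_norm,
    div_eq_mul_inv, mul_assoc, mul_comm (‖z.1 - z.2‖ₑ ^ _)⁻¹]

theorem gagliardo_eq_eLpNorm_diffQuot (hp : 1 ≤ p) (hs0 : 0 < s) (hs1 : s < 1) (u : Euc n → ℝ) :
    gagliardo n s p u = eLpNorm (diffQuot n s p u) (ENNReal.ofReal p) volume := by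
  have hp0 : 0 < p := one_pos.trans_le hp
  rw [gagliardo, if_neg hs1.ne, gagliardoIntegral,
    eLpNorm_eq_lintegral_rpow_enorm_toReal (by simpa using hp0) ENNReal.ofReal_ne_top,
    ENNReal.toReal_ofReal hp0.le, ← lintegral_const_mul' _ _ ENNReal.ofReal_ne_top]
  simp only [enorm_diffQuot_rpow hp0 hs0.le hs1.le]

theorem diffQuot_sub (u v : Euc n → ℝ) :
    diffQuot n s p (u - v) = diffQuot n s p u - diffQuot n s p v := by
  ext z
  simp only [diffQuot, Pi.sub_apply]
  ring

theorem aestronglyMeasurable_diffQuot {u : Euc n → ℝ} (hu : AEStronglyMeasurable u volume) :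
    AEStronglyMeasurable (diffQuot n s p u) volume :=
  .mul (Measurable.aestronglyMeasurable (by fun_prop))
    ((hu.comp_quasiMeasurePreserving Measure.quasiMeasurePreserving_fst).sub
      (hu.comp_quasiMeasurePreserving Measure.quasiMeasurePreserving_snd))

theorem memLp_diffQuot (hp : 1 ≤ p) (hs0 : 0 < s) (hs1 : s < 1) {u : Euc n → ℝ}
    (hu : AEStronglyMeasurable u volume) (hsemi : gagliardo n s p u < ⊤) :
    MemLp (diffQuot n s p u) (ENNReal.ofReal p) volume :=
  ⟨aestronglyMeasurable_diffQuot hu, gagliardo_eq_eLpNorm_diffQuot hp hs0 hs1 u ▸ hsemi⟩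

end diffQuot

section weakGradient

theorem continuous_gradient {X : Type*} [NormedAddCommGroup X] [InnerProductSpace ℝ X]
    [CompleteSpace X] {v : X → ℝ} (hv : ContDiff ℝ 1 v) : Continuous (gradient v) :=
  (LinearIsometryEquiv.continuous _).comp (hv.continuous_fderiv one_ne_zero)

variable {n : ℕ} {p : ℝ}

theorem IsWeakGradient.ae_eq {u : Euc n → ℝ} {G H : Euc n → Euc n} (hG : IsWeakGradient n u G)
    (hH : IsWeakGradient n u H) : G =ᵐ[volume] H := by
  refine ae_eq_of_integral_contDiff_smul_eq hG.1 hH.1 fun φ hφ hc => ?_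
  have hint {F : Euc n → Euc n} (hF : LocallyIntegrable F volume) :
      Integrable (fun x => φ x • F x) :=
    hF.integrable_smul_left_of_hasCompactSupport hφ.continuous hc
  refine ext_inner_right ℝ fun v => ?_
  have hparts := neg_inj.1 ((hG.2 φ ⟨hφ, hc⟩ v).symm.trans (hH.2 φ ⟨hφ, hc⟩ v))
  rw [real_inner_comm, ← integral_inner (hint hG.1), real_inner_comm, ← integral_inner (hint hH.1)]
  simpa only [real_inner_smul_right, mul_comm, real_inner_comm] using hparts

theorem IsWeakGradient.gagliardo_eq {u : Euc n → ℝ} {G : Euc n → Euc n}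
    (hG : IsWeakGradient n u G) : gagliardo n 1 p u = eLpNorm G (ENNReal.ofReal p) volume := by
  rw [gagliardo, if_pos rfl]
  exact le_antisymm (iInf₂_le G hG) (le_iInf₂ fun H hH => (eLpNorm_congr_ae (hG.ae_eq hH)).le)

theorem exists_isWeakGradient {u : Euc n → ℝ} (hu : gagliardo n 1 p u < ⊤) :
    ∃ G, IsWeakGradient n u G ∧ MemLp G (ENNReal.ofReal p) volume := by
  simp only [gagliardo, if_true, gradNorm, iInf_lt_iff] at hu
  obtain ⟨G, hG, hfin⟩ := hu
  exact ⟨G, hG, hG.1.aestronglyMeasurable, hfin⟩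

theorem IsWeakGradient.sub {u v : Euc n → ℝ} {G H : Euc n → Euc n}
    (hG : IsWeakGradient n u G) (hu : LocallyIntegrable u volume)
    (hH : IsWeakGradient n v H) (hv : LocallyIntegrable v volume) :
    IsWeakGradient n (u - v) (G - H) := by
  simpa only [sub_eq_add_neg, neg_smul, one_smul] using hG.add hu (hv.smul (-1)) (hH.smul (-1))

theorem isWeakGradient_gradient {v : Euc n → ℝ} (hv : ContDiff ℝ 1 v) :
    IsWeakGradient n v (gradient v) := by
  refine ⟨(continuous_gradient hv).locallyIntegrable, fun ψ hψ w => ?_⟩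
  simp only [inner_gradient]
  have hfderiv : Continuous fun x => fderiv ℝ v x w :=
    (hv.continuous_fderiv one_ne_zero).clm_apply continuous_const
  exact integral_mul_fderiv_eq_neg_fderiv_mul_of_integrable
    (integrable_mul_test hfderiv.locallyIntegrable hψ.1.continuous hψ.2)
    (integrable_mul_test hv.continuous.locallyIntegrable (hψ.continuous_fderiv w)
      (hψ.compact_fderiv w))
    (integrable_mul_test hv.continuous.locallyIntegrable hψ.1.continuous hψ.2)
    (fun x _ => hv.differentiable one_ne_zero x) (fun x _ => hψ.1.differentiable (by simp) x)

theorem gagliardo_one_eq_eLpNorm_gradient {v : Euc n → ℝ} (hv : ContDiff ℝ 1 v) :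
    gagliardo n 1 p v = eLpNorm (gradient v) (ENNReal.ofReal p) volume :=
  (isWeakGradient_gradient hv).gagliardo_eq

theorem memLp_gradient {v : Euc n → ℝ} (hv : ContDiff ℝ 1 v) (hsemi : gagliardo n 1 p v < ⊤) :
    MemLp (gradient v) (ENNReal.ofReal p) volume :=
  ⟨(continuous_gradient hv).aestronglyMeasurable, gagliardo_one_eq_eLpNorm_gradient hv ▸ hsemi⟩

end weakGradient

/-! ### The Poincaré inequality -/

section translation

theorem sub_translate_eq_integral_gradient {X : Type*} [NormedAddCommGroup X]
    [InnerProductSpace ℝ X] [CompleteSpace X] {v : X → ℝ} (hv : ContDiff ℝ 1 v) (x h : X) :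
    v x - v (x - h) = ∫ t in Ioc (0 : ℝ) 1, inner ℝ (gradient v (x - t • h)) h := by
  have hderiv (t : ℝ) : HasDerivAt (fun t : ℝ => -v (x - t • h))
      (inner ℝ (gradient v (x - t • h)) h) t := by
    have hline : HasDerivAt (fun t : ℝ => x - t • h) (-h) t := by
      simpa using ((hasDerivAt_id t).smul_const h).const_sub x
    have hcomp := ((hv.differentiable one_ne_zero (x - t • h)).hasFDerivAt.comp_hasDerivAt t
      hline).neg
    rwa [map_neg, neg_neg, ← inner_gradient] at hcomp
  have hcont := continuous_gradient hv
  rw [← intervalIntegral.integral_of_le zero_le_one,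
    intervalIntegral.integral_eq_sub_of_hasDerivAt (fun t _ => hderiv t)
      (Continuous.intervalIntegrable (by fun_prop) _ _), one_smul, zero_smul, sub_zero]
  ring

variable {n : ℕ} {p : ℝ≥0∞}

theorem eLpNorm_sub_translate_le_gradient (hp : 1 ≤ p) (hp' : p ≠ ⊤) {v : Euc n → ℝ}
    (hv : ContDiff ℝ 1 v) (h : Euc n) :
    eLpNorm (fun x => v x - v (x - h)) p volume ≤ ‖h‖ₑ * eLpNorm (gradient v) p volume := by
  have hcont := continuous_gradient hv
  have : IsProbabilityMeasure (volume.restrict (Ioc (0 : ℝ) 1)) := ⟨by simp⟩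
  simp only [sub_translate_eq_integral_gradient hv]
  refine eLpNorm_integral_le (F := fun t x => inner ℝ (gradient v (x - t • h)) h) ?_ hp hp'
    (.of_forall fun t => ?_)
  · exact Continuous.aestronglyMeasurable (by unfold Function.uncurry; fun_prop)
  · rw [← eLpNorm_comp_measurePreserving hcont.aestronglyMeasurable
      (measurePreserving_sub_right volume (t • h))]
    refine eLpNorm_le_nnreal_smul_eLpNorm_of_ae_le_mul (c := ‖h‖₊) (.of_forall fun x => ?_) p
    rw [mul_comm]
    exact nnnorm_inner_le_nnnorm (𝕜 := ℝ) _ _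

theorem IsWeakGradient.eLpNorm_sub_translate_le (hp : 1 ≤ p) (hp' : p ≠ ⊤) {u : Euc n → ℝ}
    {G : Euc n → Euc n} (hG : IsWeakGradient n u G) (hu : LocallyIntegrable u volume)
    (h : Euc n) :
    eLpNorm (fun x => u x - u (x - h)) p volume ≤ ‖h‖ₑ * eLpNorm G p volume := by
  have hlim := ae_tendsto_moll hu
  refine Lp.eLpNorm_le_of_ae_tendsto (u := atTop)
    (f := fun (k : ℕ) x => moll k u x - moll k u (x - h)) (.of_forall fun k => ?_)
    (fun k => ?_) ?_
  · calc eLpNorm (fun x => moll k u x - moll k u (x - h)) p volume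
        ≤ ‖h‖ₑ * eLpNorm (moll k G) p volume := by
          rw [← gradient_moll hu hG]
          exact eLpNorm_sub_translate_le_gradient hp hp' ((contDiff_moll hu).of_le (by simp)) h
      _ ≤ ‖h‖ₑ * eLpNorm G p volume := by
          gcongr
          exact eLpNorm_moll_le hp hp' hG.1.aestronglyMeasurable
  · have hcont : Continuous (moll k u) := (contDiff_moll hu).continuous
    exact Continuous.aestronglyMeasurable (by fun_prop)
  · filter_upwards [hlim, (measurePreserving_sub_right volume h).quasiMeasurePreserving.ae hlim]
      with x hx hxh
    exact hx.sub hxh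

end translation

section poincare

theorem lintegral_ball_prod_le_lintegral_translate {X : Type*} [NormedAddCommGroup X]
    [MeasurableSpace X] [BorelSpace X] [SecondCountableTopology X] {μ : Measure X} [SFinite μ]
    [μ.IsAddLeftInvariant] {F : X × X → ℝ≥0∞} (hF : AEMeasurable F (μ.prod μ)) (x₀ : X) (ρ : ℝ) :
    ∫⁻ z in ball x₀ ρ ×ˢ ball x₀ ρ, F z ∂μ.prod μ ≤
      ∫⁻ h in ball 0 (2 * ρ), ∫⁻ x, F (x, x + h) ∂μ ∂μ := by
  have hshear := measurePreserving_prod_add μ μ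
  have hsub : ball x₀ ρ ×ˢ ball x₀ ρ ⊆ {z : X × X | z.2 - z.1 ∈ ball (0 : X) (2 * ρ)} := by
    rintro z ⟨hz1, hz2⟩
    rw [mem_ofPred_eq, mem_ball_zero_iff, ← dist_eq_norm, two_mul]
    exact (dist_triangle_right _ _ x₀).trans_lt (add_lt_add hz2 hz1)
  have hpre : (fun z : X × X => (z.1, z.1 + z.2)) ⁻¹' {z | z.2 - z.1 ∈ ball (0 : X) (2 * ρ)} =
      univ ×ˢ ball 0 (2 * ρ) := by
    ext z
    simp
  refine (lintegral_mono_set hsub).trans_eq ?_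
  rw [← hshear.setLIntegral_comp_preimage_emb (MeasurableEquiv.shearAddRight X).measurableEmbedding,
    hpre, setLIntegral_prod_symm (fun z => F (z.1, z.1 + z.2))
      (hF.comp_quasiMeasurePreserving hshear.quasiMeasurePreserving).restrict]
  simp only [Measure.restrict_univ]

theorem enorm_sub_setAverage_rpow_le {α : Type*} [MeasurableSpace α] {μ : Measure α} {A : Set α}
    (hA0 : μ A ≠ 0) (hA : μ A ≠ ⊤) {p : ℝ} (hp : 1 ≤ p) {u : α → ℝ} (hu : IntegrableOn u A μ)
    (a : ℝ) :
    ‖a - ⨍ y in A, u y ∂μ‖ₑ ^ p ≤ (μ A)⁻¹ * ∫⁻ y in A, ‖a - u y‖ₑ ^ p ∂μ := by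
  have : IsFiniteMeasure (μ.restrict A) := ⟨by simpa using hA.lt_top⟩
  have : NeZero (μ.restrict A) := ⟨by simpa using hA0⟩
  set ν := (μ.restrict A univ)⁻¹ • μ.restrict A with hν
  have huν : Integrable u ν :=
    hu.integrable.smul_measure (ENNReal.inv_ne_top.2 (by simpa using hA0))
  have hmean : a - ⨍ y in A, u y ∂μ = ∫ y, (a - u y) ∂ν := by
    rw [average, integral_sub (integrable_const a) huν, integral_const, probReal_univ, one_smul]
  calc ‖a - ⨍ y in A, u y ∂μ‖ₑ ^ p ≤ ∫⁻ y, ‖a - u y‖ₑ ^ p ∂ν := by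
        rw [hmean]
        exact enorm_integral_rpow_le (aestronglyMeasurable_const.sub huν.1) hp
    _ = (μ A)⁻¹ * ∫⁻ y in A, ‖a - u y‖ₑ ^ p ∂μ := by
        rw [hν, lintegral_smul_measure, Measure.restrict_apply_univ, smul_eq_mul]

variable {n : ℕ} {s p : ℝ}

theorem volume_ball_eq (x₀ : Euc n) {ρ : ℝ} (hρ : 0 < ρ) :
    volume (ball x₀ ρ) = ENNReal.ofReal ρ ^ (n : ℝ) * volume (ball (0 : Euc n) 1) := by
  rw [Measure.addHaar_ball_of_pos _ _ hρ, finrank_euclideanSpace, Fintype.card_fin,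
    ENNReal.ofReal_pow hρ.le, ENNReal.rpow_natCast]

theorem lintegral_ball_prod_le_fractional (hp : 0 < p) (hs : 0 ≤ s) (u : Euc n → ℝ) (x₀ : Euc n)
    (ρ : ℝ) :
    ∫⁻ z in ball x₀ ρ ×ˢ ball x₀ ρ, ‖u z.1 - u z.2‖ₑ ^ p ≤
      ENNReal.ofReal (2 * ρ) ^ ((n : ℝ) + s * p) * gagliardoIntegral n s p u := by
  have ha : 0 ≤ (n : ℝ) + s * p := by positivity
  have hpt : ∀ z ∈ ball x₀ ρ ×ˢ ball x₀ ρ, ‖u z.1 - u z.2‖ₑ ^ p ≤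
      ENNReal.ofReal (2 * ρ) ^ ((n : ℝ) + s * p) *
        (‖u z.1 - u z.2‖ₑ ^ p / ‖z.1 - z.2‖ₑ ^ ((n : ℝ) + s * p)) := by
    rintro z ⟨hz1, hz2⟩
    rcases eq_or_ne z.1 z.2 with h | h
    · simp [h, hp]
    have hz : ‖z.1 - z.2‖ₑ ≠ 0 := by simpa [sub_eq_zero] using h
    have hdist : ‖z.1 - z.2‖ₑ ≤ ENNReal.ofReal (2 * ρ) := by
      rw [← ofReal_norm, ← dist_eq_norm, two_mul]
      exact ENNReal.ofReal_le_ofReal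
        ((dist_triangle_right _ _ x₀).trans (add_le_add hz1.le hz2.le))
    calc ‖u z.1 - u z.2‖ₑ ^ p
        = ‖z.1 - z.2‖ₑ ^ ((n : ℝ) + s * p) *
          (‖u z.1 - u z.2‖ₑ ^ p / ‖z.1 - z.2‖ₑ ^ ((n : ℝ) + s * p)) :=
        (ENNReal.mul_div_cancel (by simp [ENNReal.rpow_eq_zero_iff, hz])
          (ENNReal.rpow_ne_top_of_nonneg ha enorm_ne_top)).symm
      _ ≤ _ := by gcongr
  rw [gagliardoIntegral, ← lintegral_const_mul' _ _
    (ENNReal.rpow_ne_top_of_nonneg ha ENNReal.ofReal_ne_top)]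
  exact (setLIntegral_mono' (measurableSet_ball.prod measurableSet_ball) hpt).trans
    (setLIntegral_le_lintegral _ _)

theorem IsWeakGradient.lintegral_sub_translate_le (hp : 1 ≤ p) {u : Euc n → ℝ}
    {G : Euc n → Euc n} (hG : IsWeakGradient n u G) (hu : LocallyIntegrable u volume)
    (h : Euc n) :
    ∫⁻ x, ‖u x - u (x + h)‖ₑ ^ p ≤ (‖h‖ₑ * eLpNorm G (ENNReal.ofReal p) volume) ^ p := by
  have hp0 : 0 < p := one_pos.trans_le hp
  have htrans := hG.eLpNorm_sub_translate_le (ENNReal.one_le_ofReal.2 hp) ENNReal.ofReal_ne_top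
    hu (-h)
  rw [eLpNorm_le_iff_lintegral_rpow_enorm_le (by simpa using hp0) ENNReal.ofReal_ne_top,
    ENNReal.toReal_ofReal hp0.le, enorm_neg] at htrans
  simpa only [sub_neg_eq_add] using htrans

theorem IsWeakGradient.lintegral_ball_prod_le (hp : 1 ≤ p) {u : Euc n → ℝ} {G : Euc n → Euc n}
    (hG : IsWeakGradient n u G) (hu : LocallyIntegrable u volume) (x₀ : Euc n) (ρ : ℝ) :
    ∫⁻ z in ball x₀ ρ ×ˢ ball x₀ ρ, ‖u z.1 - u z.2‖ₑ ^ p ≤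
      (ENNReal.ofReal (2 * ρ) * eLpNorm G (ENNReal.ofReal p) volume) ^ p *
        volume (ball (0 : Euc n) (2 * ρ)) := by
  have hmeas : AEMeasurable (fun z : Euc n × Euc n => ‖u z.1 - u z.2‖ₑ ^ p)
      (volume.prod volume) :=
    ((hu.aestronglyMeasurable.comp_quasiMeasurePreserving Measure.quasiMeasurePreserving_fst).sub
      (hu.aestronglyMeasurable.comp_quasiMeasurePreserving
        Measure.quasiMeasurePreserving_snd)).enorm.pow_const _
  refine (lintegral_ball_prod_le_lintegral_translate hmeas x₀ ρ).trans ?_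
  rw [← setLIntegral_const]
  refine setLIntegral_mono' measurableSet_ball fun h hh => ?_
  have hnorm : ‖h‖ₑ ≤ ENNReal.ofReal (2 * ρ) := by
    rw [← ofReal_norm]
    exact ENNReal.ofReal_le_ofReal (mem_ball_zero_iff.1 hh).le
  exact (hG.lintegral_sub_translate_le hp hu h).trans
    (ENNReal.rpow_le_rpow (mul_le_mul' hnorm le_rfl) (zero_le_one.trans hp))

theorem exists_lintegral_ball_prod_le (n : ℕ) (hs0 : 0 < s) (hs1 : s ≤ 1) (hp : 1 ≤ p) :
    ∃ C : ℝ≥0∞, C ≠ ⊤ ∧ ∀ u : Euc n → ℝ, MemLpLoc n p u → gagliardo n s p u < ⊤ →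
      ∀ (x₀ : Euc n) (ρ : ℝ), 0 < ρ →
      ∫⁻ z in ball x₀ ρ ×ˢ ball x₀ ρ, ‖u z.1 - u z.2‖ₑ ^ p ≤
        C * ENNReal.ofReal ρ ^ ((n : ℝ) + s * p) * gagliardo n s p u ^ p := by
  have hp0 : 0 < p := one_pos.trans_le hp
  have hdouble {ρ : ℝ} : ENNReal.ofReal (2 * ρ) = 2 * ENNReal.ofReal ρ := by
    rw [ENNReal.ofReal_mul zero_le_two, ENNReal.ofReal_ofNat]
  have hpow : (2 : ℝ≥0∞) ^ ((n : ℝ) + s * p) ≠ ⊤ :=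
    ENNReal.rpow_ne_top_of_nonneg (by positivity) ENNReal.ofNat_ne_top
  rcases hs1.lt_or_eq with hs1 | rfl
  · have hc : ENNReal.ofReal (s * (1 - s)) ≠ 0 := by
      simpa using mul_pos hs0 (sub_pos.2 hs1)
    refine ⟨2 ^ ((n : ℝ) + s * p) * (ENNReal.ofReal (s * (1 - s)))⁻¹,
      ENNReal.mul_ne_top hpow (ENNReal.inv_ne_top.2 hc), fun u _ _ x₀ ρ _ => ?_⟩
    refine (lintegral_ball_prod_le_fractional hp0 hs0.le u x₀ ρ).trans_eq ?_
    rw [gagliardo, if_neg hs1.ne, ← ENNReal.rpow_mul, one_div_mul_cancel hp0.ne',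
      ENNReal.rpow_one, hdouble, ENNReal.mul_rpow_of_nonneg _ _ (by positivity),
      mul_right_comm _ _⁻¹, mul_assoc _ _⁻¹, ENNReal.inv_mul_cancel_left hc ENNReal.ofReal_ne_top]
  · refine ⟨2 ^ ((n : ℝ) + 1 * p) * volume (ball (0 : Euc n) 1),
      ENNReal.mul_ne_top hpow measure_ball_lt_top.ne, fun u hu hsemi x₀ ρ hρ => ?_⟩
    obtain ⟨G, hG, -⟩ := exists_isWeakGradient hsemi
    refine (hG.lintegral_ball_prod_le hp (hu.locallyIntegrable hp) x₀ ρ).trans_eq ?_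
    rw [hG.gagliardo_eq, volume_ball_eq _ (by positivity), hdouble, one_mul,
      ENNReal.mul_rpow_of_nonneg _ _ hp0.le, ENNReal.mul_rpow_of_nonneg _ _ hp0.le,
      ENNReal.mul_rpow_of_nonneg _ _ n.cast_nonneg,
      ENNReal.rpow_add_of_nonneg _ _ n.cast_nonneg hp0.le,
      ENNReal.rpow_add_of_nonneg _ _ n.cast_nonneg hp0.le]
    ring

theorem MemLpLoc.integrableOn_ball (hp : 1 ≤ p) {u : Euc n → ℝ} (hu : MemLpLoc n p u)
    (x₀ : Euc n) (ρ : ℝ) : IntegrableOn u (ball x₀ ρ) volume :=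
  ((hu.locallyIntegrable hp).integrableOn_isCompact (isCompact_closedBall x₀ ρ)).mono_set
    ball_subset_closedBall

theorem lintegral_ball_sub_average_le (hp : 1 ≤ p) {u : Euc n → ℝ} (hu : MemLpLoc n p u)
    {x₀ y₀ : Euc n} {ρ r : ℝ} (hr : 0 < r) (hrρ : ball y₀ r ⊆ ball x₀ ρ) :
    ∫⁻ x in ball x₀ ρ, ‖u x - ⨍ y in ball y₀ r, u y‖ₑ ^ p ≤
      (volume (ball y₀ r))⁻¹ *
        ∫⁻ z in ball x₀ ρ ×ˢ ball x₀ ρ, ‖u z.1 - u z.2‖ₑ ^ p := by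
  have hvol : volume (ball y₀ r) ≠ 0 := (measure_ball_pos _ _ hr).ne'
  have hmeas : AEMeasurable (fun z : Euc n × Euc n => ‖u z.1 - u z.2‖ₑ ^ p)
      ((volume.restrict (ball x₀ ρ)).prod (volume.restrict (ball x₀ ρ))) :=
    ((hu.1.restrict.comp_quasiMeasurePreserving Measure.quasiMeasurePreserving_fst).sub
      (hu.1.restrict.comp_quasiMeasurePreserving
        Measure.quasiMeasurePreserving_snd)).enorm.pow_const _
  rw [Measure.volume_eq_prod, ← Measure.prod_restrict, lintegral_prod _ hmeas,
    ← lintegral_const_mul' _ _ (ENNReal.inv_ne_top.2 hvol)]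
  refine lintegral_mono fun x => ?_
  refine (enorm_sub_setAverage_rpow_le hvol measure_ball_lt_top.ne hp
    (hu.integrableOn_ball hp y₀ r) (u x)).trans ?_
  gcongr

theorem exists_lintegral_ball_sub_average_le (n : ℕ) (hs0 : 0 < s) (hs1 : s ≤ 1) (hp : 1 ≤ p) :
    ∃ C : ℝ≥0∞, C ≠ ⊤ ∧ ∀ u : Euc n → ℝ, MemLpLoc n p u → gagliardo n s p u < ⊤ →
      ∀ (x₀ : Euc n) (ρ : ℝ), 0 < ρ →
      ∫⁻ x in ball x₀ ρ, ‖u x - ⨍ y in ball x₀ ρ, u y‖ₑ ^ p ≤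
        ENNReal.ofReal ρ ^ (s * p) * (C * gagliardo n s p u ^ p) := by
  obtain ⟨C, hC, hpoincare⟩ := exists_lintegral_ball_prod_le n hs0 hs1 hp
  have hunit : volume (ball (0 : Euc n) 1) ≠ 0 := (measure_ball_pos _ _ one_pos).ne'
  refine ⟨(volume (ball (0 : Euc n) 1))⁻¹ * C, ENNReal.mul_ne_top (ENNReal.inv_ne_top.2 hunit) hC,
    fun u hu hsemi x₀ ρ hρ => ?_⟩
  have hρ0 : ENNReal.ofReal ρ ≠ 0 := by simpa using hρ
  refine (lintegral_ball_sub_average_le hp hu hρ subset_rfl).trans ?_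
  refine (mul_le_mul_right (hpoincare u hu hsemi x₀ ρ hρ) _).trans_eq ?_
  have hcancel : (ENNReal.ofReal ρ ^ (n : ℝ))⁻¹ * ENNReal.ofReal ρ ^ ((n : ℝ) + s * p) =
      ENNReal.ofReal ρ ^ (s * p) := by
    rw [← ENNReal.rpow_neg, ← ENNReal.rpow_add _ _ hρ0 ENNReal.ofReal_ne_top, neg_add_cancel_left]
  rw [volume_ball_eq _ hρ, ENNReal.mul_inv (.inr measure_ball_lt_top.ne) (.inr hunit), ← hcancel]
  ring

theorem campanato_lt_top (hs0 : 0 < s) (hs1 : s ≤ 1) (hp : 1 ≤ p) {u : Euc n → ℝ}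
    (hu : MemLpLoc n p u) (hsemi : gagliardo n s p u < ⊤) : campanato n p (s * p) u < ⊤ := by
  have hp0 : 0 < p := one_pos.trans_le hp
  obtain ⟨C, hC, hosc⟩ := exists_lintegral_ball_sub_average_le n hs0 hs1 hp
  have hfin : (C * gagliardo n s p u ^ p) ^ (1 / p) < ⊤ :=
    ENNReal.rpow_lt_top_of_nonneg (by positivity)
      (ENNReal.mul_ne_top hC (ENNReal.rpow_ne_top_of_nonneg hp0.le hsemi.ne))
  refine (iSup_le fun x₀ => iSup₂_le fun ρ hρ => ?_).trans_lt hfin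
  have hρ0 : ENNReal.ofReal ρ ≠ 0 := by simpa using hρ
  calc ENNReal.ofReal (ρ ^ (-(s * p) / p)) *
        (∫⁻ x in ball x₀ ρ, ‖u x - ⨍ y in ball x₀ ρ, u y‖ₑ ^ p) ^ (1 / p)
      = (ENNReal.ofReal ρ ^ (-(s * p)) *
          ∫⁻ x in ball x₀ ρ, ‖u x - ⨍ y in ball x₀ ρ, u y‖ₑ ^ p) ^ (1 / p) := by
        rw [ENNReal.mul_rpow_of_nonneg _ _ (by positivity), ← ENNReal.rpow_mul, mul_one_div,
          ENNReal.ofReal_rpow_of_pos hρ]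
    _ ≤ (ENNReal.ofReal ρ ^ (-(s * p)) *
          (ENNReal.ofReal ρ ^ (s * p) * (C * gagliardo n s p u ^ p))) ^ (1 / p) := by
        gcongr
        exact hosc u hu hsemi x₀ ρ hρ
    _ = (C * gagliardo n s p u ^ p) ^ (1 / p) := by
        rw [← mul_assoc, ← ENNReal.rpow_add _ _ hρ0 ENNReal.ofReal_ne_top, neg_add_cancel,
          ENNReal.rpow_zero, one_mul]

theorem exists_eLpNorm_ball_le (n : ℕ) (hs0 : 0 < s) (hs1 : s ≤ 1) (hp : 1 ≤ p) (R : ℝ) :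
    ∃ K : ℝ≥0∞, K ≠ ⊤ ∧ ∀ u : Euc n → ℝ, MemLpLoc n p u → gagliardo n s p u < ⊤ →
      ⨍ y in ball (0 : Euc n) 1, u y = 0 →
      eLpNorm u (ENNReal.ofReal p) (volume.restrict (ball 0 R)) ≤ K * gagliardo n s p u := by
  have hp0 : 0 < p := one_pos.trans_le hp
  have hball : ball (0 : Euc n) R ⊆ ball 0 (max R 1) := ball_subset_ball (le_max_left R 1)
  obtain ⟨C, hC, hpoincare⟩ := exists_lintegral_ball_prod_le n hs0 hs1 hp
  have hunit : volume (ball (0 : Euc n) 1) ≠ 0 := (measure_ball_pos _ _ one_pos).ne'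
  set A := (volume (ball (0 : Euc n) 1))⁻¹ *
    (C * ENNReal.ofReal (max R 1) ^ ((n : ℝ) + s * p))
  have hA : A ≠ ⊤ := ENNReal.mul_ne_top (ENNReal.inv_ne_top.2 hunit)
    (ENNReal.mul_ne_top hC (ENNReal.rpow_ne_top_of_nonneg (by positivity) ENNReal.ofReal_ne_top))
  refine ⟨A ^ (1 / p), ENNReal.rpow_ne_top_of_nonneg (by positivity) hA,
    fun u hu hsemi hmean => ?_⟩
  rw [eLpNorm_le_iff_lintegral_rpow_enorm_le (by simpa using hp0) ENNReal.ofReal_ne_top,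
    ENNReal.toReal_ofReal hp0.le, ENNReal.mul_rpow_of_nonneg _ _ hp0.le, ← ENNReal.rpow_mul,
    one_div_mul_cancel hp0.ne', ENNReal.rpow_one]
  have hosc := (lintegral_ball_sub_average_le hp hu one_pos
    (ball_subset_ball (le_max_right R 1))).trans
      (mul_le_mul_right (hpoincare u hu hsemi 0 (max R 1) (by positivity)) _)
  refine (lintegral_mono_set hball).trans ?_
  simpa only [hmean, sub_zero, A, mul_assoc] using hosc

end poincare

/-! ### Definiteness and completeness -/

section complete

variable {n : ℕ} {s p : ℝ}

theorem ae_of_ae_restrict_ball {P : Euc n → Prop}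
    (h : ∀ R : ℝ, ∀ᵐ x ∂(volume.restrict (ball (0 : Euc n) R)), P x) : ∀ᵐ x, P x := by
  rw [← Measure.restrict_univ (μ := volume), ← iUnion_ball_nat (0 : Euc n),
    ae_restrict_iUnion_iff]
  exact fun m => h m

theorem memLpLoc_of_continuous {v : Euc n → ℝ} (hv : Continuous v) : MemLpLoc n p v := by
  refine ⟨hv.aestronglyMeasurable, fun K hK => ?_⟩
  have : IsFiniteMeasure (volume.restrict K) := ⟨by simpa using hK.measure_lt_top⟩
  obtain ⟨M, hM⟩ := hK.exists_bound_of_continuousOn hv.continuousOn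
  exact .of_bound hv.aestronglyMeasurable M
    (ae_restrict_of_forall_mem hK.measurableSet hM)

theorem MemLpLoc.sub {u v : Euc n → ℝ} (hu : MemLpLoc n p u) (hv : MemLpLoc n p v) :
    MemLpLoc n p (u - v) := by
  simpa [sub_eq_add_neg] using hu.add (hv.smul (-1))

theorem MemLpLoc.memLp_ball {u : Euc n → ℝ} (hu : MemLpLoc n p u) (R : ℝ) :
    MemLp u (ENNReal.ofReal p) (volume.restrict (ball 0 R)) :=
  (hu.2 _ (isCompact_closedBall 0 R)).mono_measure
    (Measure.restrict_mono ball_subset_closedBall le_rfl)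

theorem const_mem_aeConst (n : ℕ) (c : ℝ) : (fun _ => c : Euc n → ℝ) ∈ aeConst n :=
  ⟨c, by simp⟩

theorem gagliardo_sub_comm (hp : 1 ≤ p) (u v : Euc n → ℝ) :
    gagliardo n s p (u - v) = gagliardo n s p (v - u) := by
  rw [← gagliardo_neg hp, neg_sub]

theorem gagliardo_lt_top_of_sub (hp : 1 ≤ p) {u v : Euc n → ℝ} (hu : MemLpLoc n p u)
    (hv : MemLpLoc n p v) (hsemi : gagliardo n s p v < ⊤) (h : gagliardo n s p (u - v) < ⊤) :
    gagliardo n s p u < ⊤ := by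
  have htri := gagliardo_add_le (s := s) hp (hu.sub hv) hv
  rw [sub_add_cancel] at htri
  exact htri.trans_lt (ENNReal.add_lt_top.2 ⟨h, hsemi⟩)

theorem gagliardo_sub_const_le (hp : 1 ≤ p) {u : Euc n → ℝ} (hu : MemLpLoc n p u) (c : ℝ) :
    gagliardo n s p (u - fun _ => c) ≤ gagliardo n s p u := by
  have htri := gagliardo_add_le (s := s) hp hu (memLpLoc_of_continuous continuous_const)
    (v := fun _ => -c)
  rwa [gagliardo_aeConst hp (const_mem_aeConst n (-c)), add_zero] at htri

theorem setAverage_ball_sub_setAverage (x₀ : Euc n) (ρ : ℝ) (u : Euc n → ℝ) :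
    ⨍ x in ball x₀ ρ, (u x - ⨍ y in ball x₀ ρ, u y) = 0 := by
  have : IsFiniteMeasure (volume.restrict (ball x₀ ρ)) :=
    ⟨by simpa using measure_ball_lt_top⟩
  rw [setAverage_eq, integral_sub_average, smul_zero]

theorem mem_aeConst_of_gagliardo_eq_zero (hs0 : 0 < s) (hs1 : s ≤ 1) (hp : 1 ≤ p)
    {u : Euc n → ℝ} (hu : MemLpLoc n p u) (h : gagliardo n s p u = 0) : u ∈ aeConst n := by
  set c := ⨍ y in ball (0 : Euc n) 1, u y
  have hv : MemLpLoc n p (u - fun _ => c) := hu.sub (memLpLoc_of_continuous continuous_const)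
  have hv0 : gagliardo n s p (u - fun _ => c) = 0 :=
    le_zero_iff.1 ((gagliardo_sub_const_le hp hu c).trans_eq h)
  have hzero : ∀ᵐ x, u x - c = 0 := by
    refine ae_of_ae_restrict_ball fun R => ?_
    obtain ⟨K, -, hK⟩ := exists_eLpNorm_ball_le n hs0 hs1 hp R
    have hnorm := hK _ hv (by simp [hv0]) (setAverage_ball_sub_setAverage 0 1 u)
    rw [hv0, mul_zero, le_zero_iff,
      eLpNorm_eq_zero_iff hv.1.restrict (by simpa using one_pos.trans_le hp)] at hnorm
    exact hnorm
  exact ⟨c, hzero.mono fun x hx => sub_eq_zero.1 hx⟩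

/-- Convergence in `L^q_loc(ℝⁿ)`: in `L^q` on every ball centred at the origin. -/
def TendstoLpLoc (q : ℝ≥0∞) (f : ℕ → Euc n → ℝ) (g : Euc n → ℝ) : Prop :=
  ∀ R : ℝ, Tendsto (fun k => eLpNorm (f k - g) q (volume.restrict (ball 0 R))) atTop (𝓝 0)

theorem TendstoLpLoc.integral_mul {q : ℝ≥0∞} (hq : 1 ≤ q) {f : ℕ → Euc n → ℝ}
    {g : Euc n → ℝ} (h : TendstoLpLoc q f g) (hf : ∀ k, LocallyIntegrable (f k) volume)
    (hg : LocallyIntegrable g volume) {ψ : Euc n → ℝ} (hψ : Continuous ψ)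
    (hc : HasCompactSupport ψ) :
    Tendsto (fun k => ∫ x, f k x * ψ x) atTop (𝓝 (∫ x, g x * ψ x)) := by
  obtain ⟨R, hR⟩ := hc.isCompact.isBounded.subset_ball 0
  have := ENNReal.HolderConjugate.conjExponent hq
  have hbound (k : ℕ) : eLpNorm ((fun x => f k x * ψ x) - fun x => g x * ψ x) 1 volume ≤
      eLpNorm (f k - g) q (volume.restrict (ball 0 R)) * eLpNorm ψ q.conjExponent volume := by
    have hsub : ((fun x => f k x * ψ x) - fun x => g x * ψ x) = (f k - g) • ψ := by
      ext x
      simp [sub_mul]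
    have hsupp : Function.support ((f k - g) • ψ) ⊆ ball 0 R :=
      (Function.support_smul_subset_right _ _).trans ((subset_tsupport ψ).trans hR)
    rw [hsub, ← eLpNorm_restrict_eq_of_support_subset hsupp]
    refine (eLpNorm_smul_le_mul_eLpNorm (p := q) (q := q.conjExponent)
      hψ.aestronglyMeasurable.restrict ?_).trans ?_
    · exact ((hf k).aestronglyMeasurable.sub hg.aestronglyMeasurable).restrict
    · gcongr
      exact Measure.restrict_le_self
  refine tendsto_integral_of_L1' _ (integrable_mul_test hg hψ hc).aestronglyMeasurable
    (Eventually.of_forall fun k => integrable_mul_test (hf k) hψ hc) ?_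
  refine tendsto_of_tendsto_of_tendsto_of_le_of_le tendsto_const_nhds ?_ (fun _ => zero_le) hbound
  simpa using ENNReal.Tendsto.mul_const (h R)
    (.inr (hψ.memLp_of_hasCompactSupport hc (p := q.conjExponent)).eLpNorm_ne_top)

theorem IsWeakGradient.of_tendsto {q : ℝ≥0∞} (hq : 1 ≤ q) {w : ℕ → Euc n → ℝ} {u : Euc n → ℝ}
    {H : ℕ → Euc n → Euc n} {G : Euc n → Euc n} (hw : ∀ k, LocallyIntegrable (w k) volume)
    (hu : LocallyIntegrable u volume) (hH : ∀ k, IsWeakGradient n (w k) (H k))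
    (hG : LocallyIntegrable G volume) (hwu : TendstoLpLoc q w u)
    (hHG : Tendsto (fun k => eLpNorm (H k - G) q volume) atTop (𝓝 0)) :
    IsWeakGradient n u G := by
  refine ⟨hG, fun φ hφ v => ?_⟩
  have hinner : TendstoLpLoc q (fun k x => inner ℝ (H k x) v) fun x => inner ℝ (G x) v := by
    intro R
    have hbound (k : ℕ) : eLpNorm ((fun x => inner ℝ (H k x) v) - fun x => inner ℝ (G x) v)
        q (volume.restrict (ball 0 R)) ≤ ENNReal.ofReal ‖v‖ * eLpNorm (H k - G) q volume := by
      refine (eLpNorm_le_mul_eLpNorm_of_ae_le_mul (g := H k - G) (c := ‖v‖)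
        (Eventually.of_forall fun x => ?_) _).trans ?_
      · rw [Pi.sub_apply, ← inner_sub_left, mul_comm]
        exact norm_inner_le_norm _ _
      · gcongr
        exact Measure.restrict_le_self
    refine tendsto_of_tendsto_of_tendsto_of_le_of_le tendsto_const_nhds ?_
      (fun _ => zero_le) hbound
    simpa using ENNReal.Tendsto.const_mul hHG (.inr (ENNReal.ofReal_ne_top (r := ‖v‖)))
  have hleft := hwu.integral_mul hq hw hu (hφ.continuous_fderiv v) (hφ.compact_fderiv v)
  have hright := hinner.integral_mul hq (fun k => locallyIntegrable_inner (hH k).1 v)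
    (locallyIntegrable_inner hG v) hφ.1.continuous hφ.2
  simp only [(hH _).2 φ hφ v] at hleft
  exact tendsto_nhds_unique hleft hright.neg

theorem tendsto_fractional_gagliardo_sub_of_cauchy (hs0 : 0 < s) (hs1 : s < 1) (hp : 1 ≤ p)
    {w : ℕ → Euc n → ℝ} {u : Euc n → ℝ} (hw : ∀ k, AEStronglyMeasurable (w k) volume)
    (hae : ∀ᵐ x, Tendsto (fun k => w k x) atTop (𝓝 (u x))) {B : ℕ → ℝ≥0∞} (hB : ∑' i, B i ≠ ⊤)
    (hcau : ∀ N i j : ℕ, N ≤ i → N ≤ j → gagliardo n s p (w i - w j) < B N) :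
    Tendsto (fun k => gagliardo n s p (w k - u)) atTop (𝓝 0) := by
  simp only [gagliardo_eq_eLpNorm_diffQuot hp hs0 hs1, diffQuot_sub] at hcau ⊢
  refine Lp.cauchy_tendsto_of_tendsto (fun k => aestronglyMeasurable_diffQuot (hw k)) _ hB hcau ?_
  filter_upwards [Measure.quasiMeasurePreserving_fst.ae hae,
    Measure.quasiMeasurePreserving_snd.ae hae] with z hz1 hz2
  exact (hz1.sub hz2).const_mul _

theorem tendsto_gradient_gagliardo_sub_of_cauchy (hp : 1 ≤ p) {w : ℕ → Euc n → ℝ}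
    {u : Euc n → ℝ} (hw : ∀ k, MemLpLoc n p (w k)) (hsemi : ∀ k, gagliardo n 1 p (w k) < ⊤)
    (hu : MemLpLoc n p u) (hwu : TendstoLpLoc (ENNReal.ofReal p) w u) {B : ℕ → ℝ≥0∞}
    (hB : ∑' i, B i ≠ ⊤)
    (hcau : ∀ N i j : ℕ, N ≤ i → N ≤ j → gagliardo n 1 p (w i - w j) < B N) :
    Tendsto (fun k => gagliardo n 1 p (w k - u)) atTop (𝓝 0) := by
  have hpe : 1 ≤ ENNReal.ofReal p := ENNReal.one_le_ofReal.2 hp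
  have hwl (k : ℕ) : LocallyIntegrable (w k) volume := (hw k).locallyIntegrable hp
  have hul : LocallyIntegrable u volume := hu.locallyIntegrable hp
  choose H hH hHp using fun k => exists_isWeakGradient (hsemi k)
  obtain ⟨G, hG, hlim⟩ := Lp.cauchy_complete_eLpNorm hpe hHp hB fun N i j hi hj => by
    rw [← ((hH i).sub (hwl i) (hH j) (hwl j)).gagliardo_eq]
    exact hcau N i j hi hj
  have hGu := IsWeakGradient.of_tendsto hpe hwl hul hH (hG.locallyIntegrable hpe) hwu hlim
  exact hlim.congr fun k => ((hH k).sub (hwl k) hGu hul).gagliardo_eq.symm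

theorem exists_tendstoLpLoc_of_cauchy (hp : 1 ≤ p) {w : ℕ → Euc n → ℝ}
    (hw : ∀ k, MemLpLoc n p (w k))
    (hcau : ∀ R : ℝ, ∃ B : ℕ → ℝ≥0∞, ∑' i, B i ≠ ⊤ ∧ ∀ N i j : ℕ, N ≤ i → N ≤ j →
      eLpNorm (w i - w j) (ENNReal.ofReal p) (volume.restrict (ball 0 R)) < B N) :
    ∃ u, MemLpLoc n p u ∧ (∀ᵐ x, Tendsto (fun k => w k x) atTop (𝓝 (u x))) ∧
      TendstoLpLoc (ENNReal.ofReal p) w u := by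
  have hpe : 1 ≤ ENNReal.ofReal p := ENNReal.one_le_ofReal.2 hp
  choose B hB hcau using hcau
  obtain ⟨u, hum, hae⟩ := exists_stronglyMeasurable_limit_of_tendsto_ae (fun k => (hw k).1)
    (ae_of_ae_restrict_ball fun R => Lp.ae_tendsto_of_cauchy_eLpNorm
      (fun k => (hw k).1.restrict) hpe (hB R) (hcau R))
  have hlim : TendstoLpLoc (ENNReal.ofReal p) w u := fun R =>
    Lp.cauchy_tendsto_of_tendsto (fun k => (hw k).1.restrict) u (hB R) (hcau R)
      (ae_restrict_of_ae hae)
  refine ⟨u, ⟨hum.aestronglyMeasurable, fun A hA => ?_⟩, hae, hlim⟩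
  obtain ⟨R, hR⟩ := hA.isBounded.subset_ball (0 : Euc n)
  exact (Lp.memLp_of_cauchy_tendsto hpe (fun k => (hw k).memLp_ball R) u
    hum.aestronglyMeasurable (hlim R)).mono_measure (Measure.restrict_mono hR le_rfl)

theorem setAverage_ball_sub (hp : 1 ≤ p) {u v : Euc n → ℝ} (hu : MemLpLoc n p u)
    (hv : MemLpLoc n p v) (x₀ : Euc n) (ρ : ℝ) :
    ⨍ y in ball x₀ ρ, (u - v) y = (⨍ y in ball x₀ ρ, u y) - ⨍ y in ball x₀ ρ, v y := by
  simp only [setAverage_eq, Pi.sub_apply]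
  rw [integral_sub (hu.integrableOn_ball hp x₀ ρ) (hv.integrableOn_ball hp x₀ ρ), smul_sub]

theorem exists_tendsto_gagliardo_sub_of_cauchy (hs0 : 0 < s) (hs1 : s ≤ 1) (hp : 1 ≤ p)
    {w : ℕ → Euc n → ℝ} (hw : ∀ k, MemLpLoc n p (w k)) (hsemi : ∀ k, gagliardo n s p (w k) < ⊤)
    (hmean : ∀ k, ⨍ y in ball (0 : Euc n) 1, w k y = 0) {B : ℕ → ℝ≥0∞} (hB : ∑' i, B i ≠ ⊤)
    (hcau : ∀ N i j : ℕ, N ≤ i → N ≤ j → gagliardo n s p (w i - w j) < B N) :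
    ∃ u, MemLpLoc n p u ∧ Tendsto (fun k => gagliardo n s p (w k - u)) atTop (𝓝 0) := by
  obtain ⟨u, hu, hae, hwu⟩ : ∃ u, MemLpLoc n p u ∧
      (∀ᵐ x, Tendsto (fun k => w k x) atTop (𝓝 (u x))) ∧
      TendstoLpLoc (ENNReal.ofReal p) w u := by
    refine exists_tendstoLpLoc_of_cauchy hp hw fun R => ?_
    obtain ⟨K, hK, hpoincare⟩ := exists_eLpNorm_ball_le n hs0 hs1 hp R
    have hK1 : K + 1 ≠ ⊤ := ENNReal.add_ne_top.2 ⟨hK, ENNReal.one_ne_top⟩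
    refine ⟨fun N => (K + 1) * B N, ?_, fun N i j hi hj => ?_⟩
    · rw [ENNReal.tsum_mul_left]
      exact ENNReal.mul_ne_top hK1 hB
    · have hij := hcau N i j hi hj
      calc eLpNorm (w i - w j) (ENNReal.ofReal p) (volume.restrict (ball 0 R))
          ≤ K * gagliardo n s p (w i - w j) :=
            hpoincare _ ((hw i).sub (hw j)) (hij.trans_le le_top)
              (by rw [setAverage_ball_sub hp (hw i) (hw j), hmean, hmean, sub_zero])
        _ ≤ (K + 1) * gagliardo n s p (w i - w j) := by gcongr; exact le_self_add
        _ < (K + 1) * B N := ENNReal.mul_lt_mul_right (by simp) hK1 hij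
  refine ⟨u, hu, ?_⟩
  rcases hs1.lt_or_eq with hs1 | rfl
  · exact tendsto_fractional_gagliardo_sub_of_cauchy hs0 hs1 hp
      (fun k => (hw k).1) hae hB hcau
  · exact tendsto_gradient_gagliardo_sub_of_cauchy hp hw hsemi hu hwu hB hcau

theorem mem_preW_iff (hs0 : 0 < s) (hs1 : s ≤ 1) (hp : 1 ≤ p) (hsp : s * p = n)
    {u : Euc n → ℝ} : u ∈ preW n s p hp ↔ MemLpLoc n p u ∧ gagliardo n s p u < ⊤ :=
  ⟨fun h => ⟨h.1.1, h.2⟩,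
    fun h => ⟨⟨h.1, hsp ▸ campanato_lt_top hs0 hs1 hp h.1 h.2⟩, h.2⟩⟩

theorem WDot.dist_mk {hp : 1 ≤ p} (u v : preW n s p hp) :
    dist (WDot.mk u : WDot n s p hp) (WDot.mk v) = (gagliardo n s p (u.1 - v.1)).toReal := by
  rw [dist_eq_norm, ← map_sub, WDot.norm_mk]
  rfl

theorem WDot.exists_mk_eq (hs0 : 0 < s) (hs1 : s ≤ 1) (hp : 1 ≤ p) (hsp : s * p = n)
    (w : WDot n s p hp) :
    ∃ v : preW n s p hp, WDot.mk v = w ∧ ⨍ y in ball (0 : Euc n) 1, v.1 y = 0 := by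
  obtain ⟨u, rfl⟩ : ∃ u, WDot.mk u = w := Submodule.mkQ_surjective _ w
  have hu := memLpLoc_of_mem_preW u
  set c := ⨍ y in ball (0 : Euc n) 1, u.1 y
  have hv : u.1 - (fun _ => c) ∈ preW n s p hp := (mem_preW_iff hs0 hs1 hp hsp).2
    ⟨hu.sub (memLpLoc_of_continuous continuous_const),
      (gagliardo_sub_const_le hp hu c).trans_lt u.2.2⟩
  exact ⟨⟨_, hv⟩, (WDot.mk_eq_mk_iff _ _).2 ⟨-c, by simp⟩, setAverage_ball_sub_setAverage 0 1 u.1⟩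

theorem completeSpace_WDot (hs0 : 0 < s) (hs1 : s ≤ 1) (hp : 1 ≤ p) (hsp : s * p = n) :
    CompleteSpace (WDot n s p hp) := by
  refine Metric.complete_of_convergent_controlled_sequences (fun N => (1 / 2 : ℝ) ^ N)
    (fun N => by positivity) fun W hW => ?_
  choose v hv hmean using fun k => WDot.exists_mk_eq hs0 hs1 hp hsp (W k)
  have hvp (k : ℕ) : MemLpLoc n p (v k).1 := memLpLoc_of_mem_preW (v k)
  have hB : ∑' N, ENNReal.ofReal ((1 / 2 : ℝ) ^ N) ≠ ⊤ := by
    rw [← ENNReal.ofReal_tsum_of_nonneg (fun N => by positivity) summable_geometric_two]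
    exact ENNReal.ofReal_ne_top
  have hcau (N i j : ℕ) (hi : N ≤ i) (hj : N ≤ j) :
      gagliardo n s p ((v i).1 - (v j).1) < ENNReal.ofReal ((1 / 2 : ℝ) ^ N) := by
    have hfin : gagliardo n s p ((v i).1 - (v j).1) ≠ ⊤ := (v i - v j).2.2.ne
    rw [ENNReal.lt_ofReal_iff_toReal_lt hfin, ← WDot.dist_mk, hv, hv]
    exact hW N i j hi hj
  obtain ⟨u, hu, hlim⟩ := exists_tendsto_gagliardo_sub_of_cauchy hs0 hs1 hp hvp
    (fun k => (v k).2.2) hmean hB hcau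
  have hu' : gagliardo n s p u < ⊤ := by
    obtain ⟨k, hk⟩ := (hlim.eventually_lt_const ENNReal.zero_lt_top).exists
    rw [gagliardo_sub_comm hp] at hk
    exact gagliardo_lt_top_of_sub hp hu (hvp k) (v k).2.2 hk
  refine ⟨WDot.mk ⟨u, (mem_preW_iff hs0 hs1 hp hsp).2 ⟨hu, hu'⟩⟩, ?_⟩
  rw [tendsto_iff_dist_tendsto_zero]
  simp only [← hv, WDot.dist_mk]
  exact (ENNReal.tendsto_toReal ENNReal.zero_ne_top).comp hlim

end complete

/-! ### Density of test functions -/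

instance (n : ℕ) : (volume : Measure (Euc n × Euc n)).IsAddHaarMeasure :=
  Measure.prod.instIsAddHaarMeasure volume volume

section mollification

variable {n : ℕ} {s p : ℝ}

theorem sub_moll_eq_integral {E : Type*} [NormedAddCommGroup E] [NormedSpace ℝ E]
    [CompleteSpace E] {k : ℕ} {u : Euc n → E} (hu : LocallyIntegrable u volume) (x : Euc n) :
    u x - moll k u x = ∫ t, (u x - u (x - t)) ∂bumpMeasure n k := by
  rw [integral_sub (integrable_const _) (integrable_sub_bumpMeasure hu x), integral_const,
    probReal_univ, one_smul, moll]

theorem diffQuot_sub_moll {k : ℕ} {u : Euc n → ℝ} (hu : LocallyIntegrable u volume)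
    (z : Euc n × Euc n) :
    diffQuot n s p (u - moll k u) z =
      ∫ t, (diffQuot n s p u z - diffQuot n s p u (z - (t, t))) ∂bumpMeasure n k := by
  have hint (x : Euc n) : Integrable (fun t => u x - u (x - t)) (bumpMeasure n k) :=
    (integrable_const _).sub (integrable_sub_bumpMeasure hu x)
  rw [diffQuot, Pi.sub_apply, Pi.sub_apply, sub_moll_eq_integral hu, sub_moll_eq_integral hu,
    ← integral_sub (hint _) (hint _), ← integral_const_mul]
  congr 1 with t
  simp only [diffQuot, Prod.fst_sub, Prod.snd_sub, sub_sub_sub_cancel_right]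
  ring

theorem tendsto_gagliardo_sub_moll (hs0 : 0 < s) (hs1 : s ≤ 1) (hp : 1 ≤ p) {u : Euc n → ℝ}
    (hu : MemLpLoc n p u) (hsemi : gagliardo n s p u < ⊤) :
    Tendsto (fun k => gagliardo n s p (u - moll k u)) atTop (𝓝 0) := by
  have hpe : 1 ≤ ENNReal.ofReal p := ENNReal.one_le_ofReal.2 hp
  have hul := hu.locallyIntegrable hp
  rcases hs1.lt_or_eq with hs1 | rfl
  · have hlim := tendsto_eLpNorm_integral_sub_translate hpe ENNReal.ofReal_ne_top
      (memLp_diffQuot hp hs0 hs1 hu.1 hsemi) (a := fun t => (t, t)) (by fun_prop) rfl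
    refine hlim.congr fun k => ?_
    rw [gagliardo_eq_eLpNorm_diffQuot hp hs0 hs1, ← funext (diffQuot_sub_moll hul)]
  · obtain ⟨G, hG, hGp⟩ := exists_isWeakGradient hsemi
    have hlim := tendsto_eLpNorm_integral_sub_translate hpe ENNReal.ofReal_ne_top hGp
      continuous_id rfl
    refine hlim.congr fun k => ?_
    have hv : ContDiff ℝ 1 (moll k u) := (contDiff_moll hul).of_le (by simp)
    rw [(hG.sub hul (isWeakGradient_gradient hv) hv.continuous.locallyIntegrable).gagliardo_eq,
      gradient_moll hul hG]
    congr 1 with x : 1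
    exact (sub_moll_eq_integral hG.1 x).symm

end mollification

section truncation

variable {n : ℕ} {s p : ℝ}

/-- A smooth truncation of `v` at height `k + 1` which does not increase differences of values. -/
def sinTrunc (k : ℕ) (v : Euc n → ℝ) : Euc n → ℝ :=
  fun x => ((k : ℝ) + 1) * Real.sin (((k : ℝ) + 1)⁻¹ * v x)

theorem contDiff_sinTrunc (k : ℕ) {m : ℕ∞} {v : Euc n → ℝ} (hv : ContDiff ℝ m v) :
    ContDiff ℝ m (sinTrunc k v) :=
  contDiff_const.mul (Real.contDiff_sin.comp (contDiff_const.mul hv))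

theorem norm_sinTrunc_le (k : ℕ) (v : Euc n → ℝ) (x : Euc n) : ‖sinTrunc k v x‖ ≤ (k : ℝ) + 1 := by
  rw [sinTrunc, norm_mul, Real.norm_of_nonneg (by positivity)]
  exact mul_le_of_le_one_right (by positivity) (Real.abs_sin_le_one _)

theorem norm_sinTrunc_sub_le (k : ℕ) (v : Euc n → ℝ) (x y : Euc n) :
    ‖sinTrunc k v x - sinTrunc k v y‖ ≤ ‖v x - v y‖ := by
  have hk : (0 : ℝ) < (k : ℝ) + 1 := by positivity
  calc ‖sinTrunc k v x - sinTrunc k v y‖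
      ≤ ((k : ℝ) + 1) * ‖((k : ℝ) + 1)⁻¹ * v x - ((k : ℝ) + 1)⁻¹ * v y‖ := by
        rw [sinTrunc, sinTrunc, ← mul_sub, norm_mul, Real.norm_of_nonneg hk.le]
        gcongr
        exact Real.abs_sin_sub_sin_le _ _
    _ = ‖v x - v y‖ := by
        rw [← mul_sub, norm_mul, Real.norm_of_nonneg (by positivity), mul_inv_cancel_left₀ hk.ne']

theorem tendsto_natCast_add_one : Tendsto (fun k : ℕ => (k : ℝ) + 1) atTop atTop :=
  tendsto_atTop_add_const_right _ _ tendsto_natCast_atTop_atTop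

theorem tendsto_sinTrunc (v : Euc n → ℝ) (x : Euc n) :
    Tendsto (fun k => sinTrunc k v x) atTop (𝓝 (v x)) := by
  have hlim := ((Real.hasDerivAt_sin 0).hasFDerivAt.lim_real (v x)).comp tendsto_natCast_add_one
  simpa [Function.comp_def, sinTrunc] using hlim

theorem gradient_sinTrunc (k : ℕ) {v : Euc n → ℝ} {x : Euc n} (hv : DifferentiableAt ℝ v x) :
    gradient (sinTrunc k v) x = Real.cos (((k : ℝ) + 1)⁻¹ * v x) • gradient v x := by
  have hk : (k : ℝ) + 1 ≠ 0 := by positivity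
  refine ext_inner_right ℝ fun w => ?_
  have hderiv : fderiv ℝ (sinTrunc k v) x = ((k : ℝ) + 1) •
      Real.cos (((k : ℝ) + 1)⁻¹ * v x) • ((k : ℝ) + 1)⁻¹ • fderiv ℝ v x :=
    ((hv.hasFDerivAt.const_mul _).sin.const_mul _).fderiv
  rw [real_inner_smul_left, inner_gradient, inner_gradient, hderiv]
  simp only [smul_apply, smul_eq_mul]
  field_simp

theorem tendsto_gradient_sinTrunc {v : Euc n → ℝ} {x : Euc n} (hv : DifferentiableAt ℝ v x) :
    Tendsto (fun k => gradient (sinTrunc k v) x) atTop (𝓝 (gradient v x)) := by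
  have harg : Tendsto (fun k : ℕ => ((k : ℝ) + 1)⁻¹ * v x) atTop (𝓝 0) := by
    simpa using (tendsto_inv_atTop_zero.comp tendsto_natCast_add_one).mul_const (v x)
  simpa [gradient_sinTrunc _ hv, Function.comp_def] using
    ((Real.continuous_cos.tendsto 0).comp harg).smul_const (gradient v x)

theorem tendsto_gagliardo_sub_sinTrunc (hs0 : 0 < s) (hs1 : s ≤ 1) (hp : 1 ≤ p)
    {v : Euc n → ℝ} (hv : ContDiff ℝ 1 v) (hsemi : gagliardo n s p v < ⊤) :
    Tendsto (fun k => gagliardo n s p (v - sinTrunc k v)) atTop (𝓝 0) := by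
  have hpe : ENNReal.ofReal p ≠ 0 := by simpa using one_pos.trans_le hp
  have htrunc (k : ℕ) : ContDiff ℝ 1 (sinTrunc k v) := contDiff_sinTrunc k (m := 1) hv
  rcases hs1.lt_or_eq with hs1 | rfl
  · simp only [gagliardo_eq_eLpNorm_diffQuot hp hs0 hs1, diffQuot_sub]
    refine tendsto_eLpNorm_sub_of_norm_le hpe ENNReal.ofReal_ne_top
      (memLp_diffQuot hp hs0 hs1 hv.continuous.aestronglyMeasurable hsemi)
      (fun k => aestronglyMeasurable_diffQuot (htrunc k).continuous.aestronglyMeasurable)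
      (fun k z => ?_) fun z => ?_
    · simp only [diffQuot, norm_mul]
      gcongr
      exact norm_sinTrunc_sub_le k v _ _
    · exact ((tendsto_sinTrunc v z.1).sub (tendsto_sinTrunc v z.2)).const_mul _
  · have hdiff (x : Euc n) : DifferentiableAt ℝ v x := hv.differentiable one_ne_zero x
    have hlim := tendsto_eLpNorm_sub_of_norm_le hpe ENNReal.ofReal_ne_top (memLp_gradient hv hsemi)
      (fun k => (continuous_gradient (htrunc k)).aestronglyMeasurable) (fun k x => ?_)
      fun x => tendsto_gradient_sinTrunc (hdiff x)
    · refine hlim.congr fun k => ?_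
      exact ((isWeakGradient_gradient hv).sub hv.continuous.locallyIntegrable
        (isWeakGradient_gradient (htrunc k))
        (htrunc k).continuous.locallyIntegrable).gagliardo_eq.symm
    · rw [gradient_sinTrunc k (hdiff x), norm_smul]
      exact mul_le_of_le_one_left (norm_nonneg _) (Real.abs_cos_le_one _)

end truncation

section cutoff

variable {n N : ℕ} {s p : ℝ} {r : ℕ → ℝ}

/-- The average of the rescaled bump functions `x ↦ bump n 0 (x / r j)`, `j < N`, used as a
cutoff; it is `0` if `N = 0`. -/
def cutoff (n N : ℕ) (r : ℕ → ℝ) : Euc n → ℝ :=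
  (N : ℝ)⁻¹ • ∑ j ∈ Finset.range N, fun x => bump n 0 ((r j)⁻¹ • x)

theorem isTest_bump (n k : ℕ) : IsTest n (bump n k) :=
  ⟨(bump n k).contDiff, (bump n k).hasCompactSupport⟩

theorem IsTest.comp_smul {φ : Euc n → ℝ} (hφ : IsTest n φ) {c : ℝ} (hc : c ≠ 0) :
    IsTest n fun x => φ (c • x) :=
  ⟨hφ.1.comp (contDiff_const_smul c), hφ.2.comp_homeomorph (Homeomorph.smulOfNeZero c hc)⟩

theorem isTest_cutoff (hr : ∀ j, 0 < r j) : IsTest n (cutoff n N r) :=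
  (testSpace n).smul_mem _ <| Submodule.sum_mem _ fun j _ =>
    (isTest_bump n 0).comp_smul (inv_ne_zero (hr j).ne')

theorem cutoff_apply (x : Euc n) :
    cutoff n N r x = (N : ℝ)⁻¹ * ∑ j ∈ Finset.range N, bump n 0 ((r j)⁻¹ • x) := by
  simp only [cutoff, Pi.smul_apply, Finset.sum_apply, smul_eq_mul]

theorem cutoff_nonneg (x : Euc n) : 0 ≤ cutoff n N r x := by
  rw [cutoff_apply]
  exact mul_nonneg (by positivity) (Finset.sum_nonneg fun _ _ => (bump n 0).nonneg)

theorem cutoff_le_one (x : Euc n) : cutoff n N r x ≤ 1 := by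
  have hsum : ∑ j ∈ Finset.range N, bump n 0 ((r j)⁻¹ • x) ≤ N := by
    simpa using Finset.sum_le_sum fun j (_ : j ∈ Finset.range N) =>
      (bump n 0).le_one (x := (r j)⁻¹ • x)
  rw [cutoff_apply]
  exact (mul_le_mul_of_nonneg_left hsum (by positivity)).trans inv_mul_le_one

theorem cutoff_eq_one (hN : 0 < N) (hr : ∀ j, 0 < r j) {x : Euc n} (hx : ∀ j, 2 * ‖x‖ ≤ r j) :
    cutoff n N r x = 1 := by
  have hbump (j : ℕ) : bump n 0 ((r j)⁻¹ • x) = 1 := by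
    refine (bump n 0).one_of_mem_closedBall ?_
    have hrIn : (bump n 0).rIn = 1 / 2 := by norm_num [bump]
    rw [mem_closedBall_zero_iff, norm_smul, norm_inv, Real.norm_of_nonneg (hr j).le,
      inv_mul_le_iff₀ (hr j), hrIn]
    linarith [hx j]
  rw [cutoff_apply]
  simp only [hbump, Finset.sum_const, Finset.card_range, nsmul_eq_mul, mul_one]
  exact inv_mul_cancel₀ (by positivity)

theorem diffQuot_comp_inv_smul (hsp : s * p = n) {ρ : ℝ} (hρ : 0 < ρ)
    (u : Euc n → ℝ) :
    diffQuot n s p (fun x => u (ρ⁻¹ • x)) = dilate p ρ (diffQuot n s p u) := by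
  ext z
  simp only [diffQuot, dilate, smul_eq_mul, Module.finrank_prod, finrank_euclideanSpace,
    Fintype.card_fin, Nat.cast_add, hsp]
  rw [Prod.smul_fst, Prod.smul_snd, ← smul_sub, norm_smul, norm_inv, Real.norm_of_nonneg hρ.le,
    Real.mul_rpow (by positivity) (norm_nonneg _), Real.inv_rpow hρ.le]
  field_simp

theorem gradient_comp_inv_smul (hn : 0 < n) {ρ : ℝ} (u : Euc n → ℝ) :
    gradient (fun x => u (ρ⁻¹ • x)) = dilate n ρ (gradient u) := by
  ext1 x
  refine ext_inner_right ℝ fun v => ?_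
  have hn' : (n : ℝ) ≠ 0 := by positivity
  rw [inner_gradient, fderiv_comp_smul, smul_apply, dilate, real_inner_smul_left, inner_gradient,
    finrank_euclideanSpace, Fintype.card_fin, div_self hn', Real.rpow_neg_one, smul_eq_mul]

theorem diffQuot_cutoff (hsp : s * p = n) (hr : ∀ j, 0 < r j) :
    diffQuot n s p (cutoff n N r) = dilationAverage p N r (diffQuot n s p (bump n 0)) := by
  have hlin : diffQuot n s p (cutoff n N r) = (N : ℝ)⁻¹ • ∑ j ∈ Finset.range N,
      diffQuot n s p (fun x => bump n 0 ((r j)⁻¹ • x)) := by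
    ext z
    simp only [diffQuot, cutoff_apply, Pi.smul_apply, Finset.sum_apply, smul_eq_mul,
      ← Finset.mul_sum, Finset.sum_sub_distrib]
    ring
  rw [hlin, dilationAverage]
  simp only [diffQuot_comp_inv_smul hsp (hr _)]

theorem gradient_cutoff (hn : 0 < n) (hr : ∀ j, 0 < r j) :
    gradient (cutoff n N r) = dilationAverage n N r (gradient (bump n 0)) := by
  have hdiff (j : ℕ) : Differentiable ℝ fun x : Euc n => bump n 0 ((r j)⁻¹ • x) :=
    ((isTest_bump n 0).comp_smul (inv_ne_zero (hr j).ne')).1.differentiable (by simp)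
  have hlin : gradient (cutoff n N r) = (N : ℝ)⁻¹ • ∑ j ∈ Finset.range N,
      gradient (fun x => bump n 0 ((r j)⁻¹ • x)) := by
    ext1 x
    simp only [gradient, Pi.smul_apply, Finset.sum_apply]
    rw [cutoff, fderiv_const_smul (.sum fun j _ => hdiff j x), fderiv_sum fun j _ => hdiff j x,
      map_smulₛₗ, map_sum, conj_trivial]
  rw [hlin, dilationAverage]
  simp only [gradient_comp_inv_smul hn]

theorem exists_gagliardo_cutoff_le (hn : 0 < n) (hs0 : 0 < s) (hs1 : s ≤ 1) (hp : 1 < p)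
    (hsp : s * p = n) (K : ℝ) {ε : ℝ≥0∞} (hε : ε ≠ 0) :
    ∃ (N : ℕ) (r : ℕ → ℝ), 0 < N ∧ (∀ j, 0 < r j) ∧ (∀ j, K ≤ r j) ∧
      gagliardo n s p (cutoff n N r) ≤ ε := by
  have : Nonempty (Fin n) := ⟨⟨0, hn⟩⟩
  have hpe : 1 < ENNReal.ofReal p := ENNReal.one_lt_ofReal.2 hp
  have hpr : (ENNReal.ofReal p).toReal = p := ENNReal.toReal_ofReal (one_pos.trans hp).le
  have hχ : ContDiff ℝ 1 (bump n 0) := (bump n 0).contDiff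
  have hχsemi := gagliardo_test_lt_top (s := s) hp.le (isTest_bump n 0)
  rcases hs1.lt_or_eq with hs1 | rfl
  · obtain ⟨N, r, hN, hr, hrK, h⟩ := exists_eLpNorm_dilationAverage_le hpe ENNReal.ofReal_ne_top
      (memLp_diffQuot hp.le hs0 hs1 hχ.continuous.aestronglyMeasurable hχsemi) K hε
    rw [hpr] at h
    refine ⟨N, r, hN, hr, hrK, ?_⟩
    rwa [gagliardo_eq_eLpNorm_diffQuot hp.le hs0 hs1, diffQuot_cutoff hsp hr]
  · obtain ⟨N, r, hN, hr, hrK, h⟩ := exists_eLpNorm_dilationAverage_le hpe ENNReal.ofReal_ne_top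
      (memLp_gradient hχ hχsemi) K hε
    rw [hpr, show p = n by rw [← hsp, one_mul]] at h
    refine ⟨N, r, hN, hr, hrK, ?_⟩
    rwa [gagliardo_one_eq_eLpNorm_gradient ((isTest_cutoff hr).1.of_le (by simp)),
      gradient_cutoff hn hr, show p = n by rw [← hsp, one_mul]]

end cutoff

section product

variable {n : ℕ} {s p : ℝ}

theorem diffQuot_sub_mul (w Ψ : Euc n → ℝ) :
    diffQuot n s p (w - Ψ * w) = (fun z : Euc n × Euc n => 1 - Ψ z.1) • diffQuot n s p w -
      (fun z : Euc n × Euc n => w z.2) • diffQuot n s p Ψ := by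
  ext z
  simp only [diffQuot, Pi.sub_apply, Pi.mul_apply, smul_eq_mul]
  ring

theorem gradient_sub_mul {w Ψ : Euc n → ℝ} (hw : Differentiable ℝ w) (hΨ : Differentiable ℝ Ψ) :
    gradient (w - Ψ * w) = (fun x => 1 - Ψ x) • gradient w - w • gradient Ψ := by
  ext1 x
  refine ext_inner_right ℝ fun v => ?_
  rw [inner_gradient, fderiv_sub (hw x) ((hΨ x).mul (hw x)), fderiv_mul (hΨ x) (hw x)]
  simp only [Pi.sub_apply, Pi.smul_apply', inner_sub_left, real_inner_smul_left, inner_gradient,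
    sub_apply, add_apply, smul_apply, smul_eq_mul]
  ring

theorem tendsto_gagliardo_sub_mul (hs0 : 0 < s) (hs1 : s ≤ 1) (hp : 1 ≤ p) {w : Euc n → ℝ}
    (hw : ContDiff ℝ 1 w) {M : ℝ} (hM : ∀ x, ‖w x‖ ≤ M) (hsemi : gagliardo n s p w < ⊤)
    {Ψ : ℕ → Euc n → ℝ} (hΨ : ∀ k, ContDiff ℝ 1 (Ψ k)) (hΨ1 : ∀ k x, ‖1 - Ψ k x‖ ≤ 1)
    (hlim : ∀ x, Tendsto (fun k => Ψ k x) atTop (𝓝 1))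
    (hΨ0 : Tendsto (fun k => gagliardo n s p (Ψ k)) atTop (𝓝 0)) :
    Tendsto (fun k => gagliardo n s p (w - Ψ k * w)) atTop (𝓝 0) := by
  have hpe : 1 ≤ ENNReal.ofReal p := ENNReal.one_le_ofReal.2 hp
  have hlim' (x : Euc n) : Tendsto (fun k => 1 - Ψ k x) atTop (𝓝 0) := by
    simpa using (hlim x).const_sub 1
  have hwc := hw.continuous
  have hΨc (k : ℕ) := (hΨ k).continuous
  rcases hs1.lt_or_eq with hs1 | rfl
  · simp only [gagliardo_eq_eLpNorm_diffQuot hp hs0 hs1, diffQuot_sub_mul] at hΨ0 ⊢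
    exact tendsto_eLpNorm_smul_sub_smul hpe ENNReal.ofReal_ne_top
      (memLp_diffQuot hp hs0 hs1 hwc.aestronglyMeasurable hsemi)
      (fun k => (continuous_const.sub ((hΨc k).comp continuous_fst)).aestronglyMeasurable)
      (fun k z => hΨ1 k z.1) (fun z => hlim' z.1)
      (hwc.comp continuous_snd).aestronglyMeasurable (fun z => hM z.2)
      (fun k => aestronglyMeasurable_diffQuot (hΨc k).aestronglyMeasurable) hΨ0
  · have hmul (k : ℕ) : gagliardo n 1 p (w - Ψ k * w) = eLpNorm
        ((fun x => 1 - Ψ k x) • gradient w - w • gradient (Ψ k)) (ENNReal.ofReal p) volume := by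
      have hprod : ContDiff ℝ 1 (w - Ψ k * w) := hw.sub ((hΨ k).mul hw)
      rw [gagliardo_one_eq_eLpNorm_gradient hprod,
        gradient_sub_mul (hw.differentiable one_ne_zero) ((hΨ k).differentiable one_ne_zero)]
    simp only [gagliardo_one_eq_eLpNorm_gradient (hΨ _)] at hΨ0
    simp only [hmul]
    exact tendsto_eLpNorm_smul_sub_smul hpe ENNReal.ofReal_ne_top (memLp_gradient hw hsemi)
      (fun k => (continuous_const.sub (hΨc k)).aestronglyMeasurable) hΨ1 hlim'
      hwc.aestronglyMeasurable hM
      (fun k => (continuous_gradient (hΨ k)).aestronglyMeasurable) hΨ0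

end product

section testLimit

variable {n : ℕ} {s p : ℝ}

/-- `u` belongs to the closure of `C_c^∞(ℝⁿ)` with respect to the seminorm. -/
def IsTestLimit (n : ℕ) (s p : ℝ) (u : Euc n → ℝ) : Prop :=
  ∀ ε : ℝ≥0∞, ε ≠ 0 → ∃ φ, IsTest n φ ∧ gagliardo n s p (u - φ) ≤ ε

theorem IsTest.isTestLimit (hp : 1 ≤ p) {φ : Euc n → ℝ} (hφ : IsTest n φ) :
    IsTestLimit n s p φ :=
  fun ε _ => ⟨φ, hφ, by rw [sub_self, gagliardo_zero hp]; exact zero_le⟩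

theorem IsTestLimit.of_tendsto (hp : 1 ≤ p) {u : Euc n → ℝ} (hu : MemLpLoc n p u)
    {v : ℕ → Euc n → ℝ} (hv : ∀ k, MemLpLoc n p (v k))
    (hlim : Tendsto (fun k => gagliardo n s p (u - v k)) atTop (𝓝 0))
    (h : ∀ᶠ k in atTop, IsTestLimit n s p (v k)) : IsTestLimit n s p u := by
  intro ε hε
  have hε2 : 0 < ε / 2 := ENNReal.half_pos hε
  obtain ⟨k, hk, hvk⟩ := ((hlim.eventually_le_const hε2).and h).exists
  obtain ⟨φ, hφ, hvφ⟩ := hvk _ hε2.ne'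
  refine ⟨φ, hφ, ?_⟩
  calc gagliardo n s p (u - φ)
      = gagliardo n s p ((u - v k) + (v k - φ)) := by rw [sub_add_sub_cancel]
    _ ≤ gagliardo n s p (u - v k) + gagliardo n s p (v k - φ) :=
        gagliardo_add_le hp (hu.sub (hv k)) ((hv k).sub hφ.memLpLoc)
    _ ≤ ε / 2 + ε / 2 := add_le_add hk hvφ
    _ = ε := ENNReal.add_halves ε

theorem eventually_gagliardo_lt_top (hp : 1 ≤ p) {u : Euc n → ℝ} (hu : MemLpLoc n p u)
    (hsemi : gagliardo n s p u < ⊤) {v : ℕ → Euc n → ℝ} (hv : ∀ k, MemLpLoc n p (v k))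
    (hlim : Tendsto (fun k => gagliardo n s p (u - v k)) atTop (𝓝 0)) :
    ∀ᶠ k in atTop, gagliardo n s p (v k) < ⊤ := by
  filter_upwards [hlim.eventually_lt_const ENNReal.zero_lt_top] with k hk
  rw [gagliardo_sub_comm hp] at hk
  exact gagliardo_lt_top_of_sub hp (hv k) hu hsemi hk

theorem isTestLimit_of_bounded (hn : 0 < n) (hs0 : 0 < s) (hs1 : s ≤ 1) (hp : 1 < p)
    (hsp : s * p = n) {w : Euc n → ℝ} (hw : ContDiff ℝ ∞ w) {M : ℝ} (hM : ∀ x, ‖w x‖ ≤ M)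
    (hsemi : gagliardo n s p w < ⊤) : IsTestLimit n s p w := by
  choose N r hN hr hrk hg using fun k : ℕ => exists_gagliardo_cutoff_le hn hs0 hs1 hp hsp
    (2 * k : ℝ) (ε := (k : ℝ≥0∞)⁻¹) (by simp)
  have htest (k : ℕ) : IsTest n (cutoff n (N k) (r k)) := isTest_cutoff (hr k)
  have hlim (x : Euc n) : Tendsto (fun k => cutoff n (N k) (r k) x) atTop (𝓝 1) := by
    refine tendsto_const_nhds.congr' ?_
    filter_upwards [(tendsto_natCast_atTop_atTop (R := ℝ)).eventually_ge_atTop ‖x‖] with k hk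
    exact (cutoff_eq_one (hN k) (hr k) fun j => by linarith [hrk k j]).symm
  have hg0 : Tendsto (fun k => gagliardo n s p (cutoff n (N k) (r k))) atTop (𝓝 0) :=
    tendsto_of_tendsto_of_tendsto_of_le_of_le tendsto_const_nhds
      ENNReal.tendsto_inv_nat_nhds_zero (fun _ => zero_le) hg
  have hprod (k : ℕ) : IsTest n (cutoff n (N k) (r k) * w) :=
    ⟨(htest k).1.mul hw, (htest k).2.mul_right⟩
  refine .of_tendsto hp.le (memLpLoc_of_continuous hw.continuous) (fun k => (hprod k).memLpLoc)
    (tendsto_gagliardo_sub_mul hs0 hs1 hp.le (hw.of_le (by simp)) hM hsemi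
      (fun k => (htest k).1.of_le (by simp)) (fun k x => ?_) hlim hg0)
    (.of_forall fun k => (hprod k).isTestLimit hp.le)
  rw [Real.norm_of_nonneg (sub_nonneg.2 (cutoff_le_one x))]
  exact sub_le_self _ (cutoff_nonneg x)

theorem isTestLimit_of_contDiff (hn : 0 < n) (hs0 : 0 < s) (hs1 : s ≤ 1) (hp : 1 < p)
    (hsp : s * p = n) {v : Euc n → ℝ} (hv : ContDiff ℝ ∞ v) (hsemi : gagliardo n s p v < ⊤) :
    IsTestLimit n s p v := by
  have hvp : MemLpLoc n p v := memLpLoc_of_continuous hv.continuous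
  have htrunc (k : ℕ) : ContDiff ℝ ∞ (sinTrunc k v) := contDiff_sinTrunc k hv
  have htruncp (k : ℕ) : MemLpLoc n p (sinTrunc k v) := memLpLoc_of_continuous (htrunc k).continuous
  have hlim := tendsto_gagliardo_sub_sinTrunc hs0 hs1 hp.le (hv.of_le (by simp)) hsemi
  refine .of_tendsto hp.le hvp htruncp hlim ?_
  filter_upwards [eventually_gagliardo_lt_top hp.le hvp hsemi htruncp hlim] with k hk
  exact isTestLimit_of_bounded hn hs0 hs1 hp hsp (htrunc k) (norm_sinTrunc_le k v) hk

theorem isTestLimit_of_gagliardo_lt_top (hn : 0 < n) (hs0 : 0 < s) (hs1 : s ≤ 1) (hp : 1 < p)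
    (hsp : s * p = n) {u : Euc n → ℝ} (hu : MemLpLoc n p u) (hsemi : gagliardo n s p u < ⊤) :
    IsTestLimit n s p u := by
  have hmoll (k : ℕ) : ContDiff ℝ ∞ (moll k u) := contDiff_moll (hu.locallyIntegrable hp.le)
  have hmollp (k : ℕ) : MemLpLoc n p (moll k u) := memLpLoc_of_continuous (hmoll k).continuous
  have hlim := tendsto_gagliardo_sub_moll hs0 hs1 hp.le hu hsemi
  refine .of_tendsto hp.le hu hmollp hlim ?_
  filter_upwards [eventually_gagliardo_lt_top hp.le hu hsemi hmollp hlim] with k hk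
  exact isTestLimit_of_contDiff hn hs0 hs1 hp hsp (hmoll k) hk

end testLimit

/-! ### The isometric isomorphism -/

theorem exists_linearIsometryEquiv_completion {E F : Type*} [SeminormedAddCommGroup E]
    [NormedSpace ℝ E] [SeminormedAddCommGroup F] [NormedSpace ℝ F] [T0Space F] [CompleteSpace F]
    (f : E →ₗᵢ[ℝ] F) (hf : DenseRange f) :
    ∃ J : UniformSpace.Completion E ≃ₗᵢ[ℝ] F, ∀ x : E, J x = f x := by
  let g : UniformSpace.Completion E →L[ℝ] F :=
    f.toContinuousLinearMap.extend UniformSpace.Completion.toComplL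
  have hg (x : E) : g x = f x := f.toContinuousLinearMap.extend_eq
    UniformSpace.Completion.denseRange_coe (UniformSpace.Completion.isUniformInducing_coe E) x
  have hnorm (x : UniformSpace.Completion E) : ‖g x‖ = ‖x‖ := by
    induction x using UniformSpace.Completion.induction_on with
    | hp => exact isClosed_eq (by fun_prop) (by fun_prop)
    | ih x => rw [hg, f.norm_map, UniformSpace.Completion.norm_coe]
  let G : UniformSpace.Completion E →ₗᵢ[ℝ] F := ⟨g.toLinearMap, hnorm⟩
  have hclosed : IsClosed (range G) := G.isometry.isUniformInducing.isComplete_range.isClosed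
  have hdense : Dense (range G) :=
    hf.mono (range_subset_iff.2 fun x : E => ⟨(x : UniformSpace.Completion E), hg x⟩)
  have hsurj : Function.Surjective G :=
    range_eq_univ.1 (hclosed.closure_eq.symm.trans hdense.closure_eq)
  exact ⟨LinearIsometryEquiv.ofSurjective G hsurj, hg⟩

section isomorphism

variable {n : ℕ} {s p : ℝ} {hp : 1 ≤ p}

theorem TestW.mem_preW (hs0 : 0 < s) (hs1 : s ≤ 1) (hsp : s * p = n) (φ : TestW n s p hp) :
    φ.toFun ∈ preW n s p hp :=
  (mem_preW_iff hs0 hs1 hp hsp).2 ⟨φ.isTest.memLpLoc, gagliardo_test_lt_top hp φ.isTest⟩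

/-- The isometric embedding `φ ↦ {φ}_C` of `C_c^∞(ℝⁿ)` into `Ẇ^{s,p}(ℝⁿ)`, for `s p = n`. -/
def TestW.toWDot (hs0 : 0 < s) (hs1 : s ≤ 1) (hsp : s * p = n) :
    TestW n s p hp →ₗᵢ[ℝ] WDot n s p hp where
  toFun φ := WDot.mk ⟨φ.toFun, φ.mem_preW hs0 hs1 hsp⟩
  map_add' φ ψ := by
    rw [← map_add]
    rfl
  map_smul' c φ := by
    rw [RingHom.id_apply, ← map_smul]
    rfl
  norm_map' _ := rfl

theorem TestW.denseRange_toWDot (hn : 0 < n) (hs0 : 0 < s) (hs1 : s ≤ 1) (hp1 : 1 < p)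
    (hsp : s * p = n) : DenseRange (TestW.toWDot (hp := hp) hs0 hs1 hsp) := by
  refine Metric.denseRange_iff.2 fun w ε hε => ?_
  obtain ⟨u, rfl⟩ : ∃ u, WDot.mk u = w := Submodule.mkQ_surjective _ w
  obtain ⟨φ, hφ, hφu⟩ := isTestLimit_of_gagliardo_lt_top hn hs0 hs1 hp1 hsp
    (memLpLoc_of_mem_preW u) u.2.2 (ENNReal.ofReal (ε / 2)) (by simpa using hε)
  refine ⟨(⟨φ, hφ⟩ : testSpace n), ?_⟩
  calc dist (WDot.mk u) (TestW.toWDot hs0 hs1 hsp (⟨φ, hφ⟩ : testSpace n))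
      = (gagliardo n s p (u.1 - φ)).toReal := WDot.dist_mk _ _
    _ ≤ ε / 2 := ENNReal.toReal_le_of_le_ofReal (by positivity) hφu
    _ < ε := half_lt_self hε

theorem WDot.eq_zero_of_norm_eq_zero (hs0 : 0 < s) (hs1 : s ≤ 1) {w : WDot n s p hp}
    (hw : ‖w‖ = 0) : w = 0 := by
  obtain ⟨u, rfl⟩ : ∃ u, WDot.mk u = w := Submodule.mkQ_surjective _ w
  have hu : gagliardo n s p u.1 = 0 :=
    ((ENNReal.toReal_eq_zero_iff _).1 hw).resolve_right u.2.2.ne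
  exact (Submodule.Quotient.mk_eq_zero _).2
    (mem_aeConst_of_gagliardo_eq_zero hs0 hs1 hp (memLpLoc_of_mem_preW u) hu)

theorem t0Space_WDot (hs0 : 0 < s) (hs1 : s ≤ 1) : T0Space (WDot n s p hp) :=
  ⟨fun v w h => by
    rw [Metric.inseparable_iff, dist_eq_norm] at h
    exact sub_eq_zero.1 (WDot.eq_zero_of_norm_eq_zero hs0 hs1 h)⟩

end isomorphism

end HomSobolev

end

open HomSobolev in
theorem theorem5p3 (n : ℕ) (s : ℝ) (hs0 : 0 < s) (hs1 : s ≤ 1) (hsn : s < n) :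
    (∀ w : WDot n s (n / s) (one_le_exponent hs0 hsn), ‖w‖ = 0 → w = 0) ∧
    CompleteSpace (WDot n s (n / s) (one_le_exponent hs0 hsn)) ∧
    ∃ J : DSpace n s (n / s) (one_le_exponent hs0 hsn) ≃ₗᵢ[ℝ]
        WDot n s (n / s) (one_le_exponent hs0 hsn),
      ∀ φ : TestW n s (n / s) (one_le_exponent hs0 hsn),
        ∃ h : φ.toFun ∈ preW n s (n / s) (one_le_exponent hs0 hsn),
          J (φ : DSpace n s (n / s) (one_le_exponent hs0 hsn)) = WDot.mk ⟨φ.toFun, h⟩ := by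
  have hsp : s * (n / s) = n := mul_div_cancel₀ _ hs0.ne'
  have hn : 0 < n := Nat.cast_pos.1 (hs0.trans hsn)
  have hp : 1 < n / s := (one_lt_div hs0).2 hsn
  have hcomplete := completeSpace_WDot hs0 hs1 (one_le_exponent hs0 hsn) hsp
  have := t0Space_WDot (n := n) (hp := one_le_exponent hs0 hsn) hs0 hs1
  obtain ⟨J, hJ⟩ := exists_linearIsometryEquiv_completion _
    (TestW.denseRange_toWDot hn hs0 hs1 hp hsp)
  exact ⟨fun w => WDot.eq_zero_of_norm_eq_zero hs0 hs1, hcomplete, J,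
    fun φ => ⟨φ.mem_preW hs0 hs1 hsp, hJ φ⟩⟩
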